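/- **Setting.** Let $f:\mathbb R^n\to\mathbb R\cup\{+\infty\}$ be closed and convex with open domain $\operatorname{dom} f=\{f<+\infty\}$, $f\in C^3(\operatorname{dom} f)$, and $(M,\nu)$-generalized self-concordant with $\nu\ge 2$: $$|\langle D^3f(x)[w]u,u\rangle|\le M\|u\|_{\nabla^2 f(x)}^2\,\|w\|_{\nabla^2 f(x)}^{\nu-2}\,\|w\|_2^{3-\nu}\qquad(x\in\operatorname{dom} f,\ u,w\in\mathbb R^n).$$ Assume that $\operatorname{dom} f$ contains no straight line. Let $\mathcal X\subset\mathbb R^n$ be a polytope with vertex set $V$ and diameter $D$, let $x_0\in\mathcal X\cap\operatorname{dom} f$, $L_{-1}>0$ and $\tau>1$. Put $h(x)=f(x)-\min_{\mathcal X}f$, $g(x)=\max_{v\in\mathcal X}\langle\nabla f(x),x-v\rangle$ and $w(x,\mathcal S)=\max_{u\in\mathcal S,\,v\in\mathcal X}\langle\nabla f(x),u-v\rangle$. **Algorithm (Away-step Frank-Wolfe with backtracking).** Start with the weights $\lambda_0(x_0)=1$; the active set $\mathcal S_t$ is the support of the weights $\lambda_t$. At iteration $t\ge 0$ let $v_t\in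 V$ minimize $\langle\nabla f(x_t),\cdot\rangle$ over $\mathcal X$ and let $a_t\in\mathcal S_t$ maximize it over $\mathcal S_t$. If $\langle\nabla f(x_t),x_t-v_t\rangle\ge\langle\nabla f(x_t),a_t-x_t\rangle$, put $d_t=v_t-x_t$, $\gamma_{\max}=1$ (Frank-Wolfe step); otherwise put $d_t=x_t-a_t$, $\gamma_{\max}=\lambda_t(a_t)/(1-\lambda_t(a_t))$ (away step). Backtracking: choose $0<\eta\le1$ and $L\in[\eta L_{t-1},L_{t-1}]$, put $\gamma=\min\{-\langle\nabla f(x_t),d_t\rangle/(L\|d_t\|^2),\gamma_{\max}\}$ (with $\gamma=0$ if $d_t=0$), and, as long as $x_t+\gamma d_t\notin\operatorname{dom} f$ or $f(x_t+\gamma d_t)-f(x_t)>\tfrac{L\gamma^2}{2}\|d_t\|^2+\gamma\langle\nabla f(x_t),d_t\rangle$, replace $L$ by $\tau L$ and recompute $\gamma$. The final values are $L_t,\gamma_t$. Put $x_{t+1}=x_t+\gamma_td_t$, and $\lambda_{t+1}=(1-\gamma_t)\lambda_t+\gamma_t\mathbf 1_{v_t}$ after a Frank-Wolfe step, $\lambda_{t+1}=(1+\gamma_t)\lambda_t-\gamma_t\mathbf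 1_{a_t}$ after an away step. **Constants.** Let $\mathcal L_0=\{x\in\mathcal X\cap\operatorname{dom} f: f(x)\le f(x_0)\}$, let $\mu$ and $L_f$ be the minimum and the maximum of $\|d\|^2_{\nabla^2f(u)}/\|d\|_2^2$ over $u\in\mathcal L_0$, $d\ne0$, and $\tilde L=\max\{\tau L_f,L_{-1}\}$. Let $\delta$ be the pyramidal width of the set of atoms $A=V\cup\{x_0\}$; if $x_0$ is a vertex, then $A=V$ and $\delta$ is the pyramidal width of $\mathcal X$. Here the pyramidal width of a finite set $A$ is the infimum of $\max_{s\in K\cap A,\,v\in S}\langle r/\|r\|,s-v\rangle$ over all faces $K$ of $\operatorname{conv}A$, points $x\in K$, nonzero $r\in\operatorname{cone}(K-x)$ and sets $S\subseteq K\cap A$ of which $x$ is a convex combination with positive weights. (If $\mathcal X$ is a single point, $\delta/D$ is read as $0$. A bound below with $h(x_0)=0$ is read as $0$.) **Theorem.** Every call of the backtracking line search terminates, and: 1. for every iteration $t\ge1$ that is not an away step with $\gamma_t=\gamma_{\max}$, $$g(x_t)\le w(x_t,\mathcal S_t)\le 4h(x_0)\max\left\{1,\sqrt{\frac{\tilde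 LD^2}{2h(x_0)}}\right\}\left(1-\frac{\mu}{4\tilde L}\Big(\frac{\delta}{D}\Big)^2\right)^{\lfloor (t-1)/4\rfloor};$$ 2. $\min_{1\le t\le T}g(x_t)\le\varepsilon$ after $T=\mathcal O(\log 1/\varepsilon)$ iterations: there is a constant $C>0$, depending only on $f,\mathcal X,x_0,L_{-1},\tau$ and not on the choices made by the algorithm, such that for all $0<\varepsilon\le\frac12$ and every run of $T\ge C\log(1/\varepsilon)$ iterations, $\min_{1\le t\le T}g(x_t)\le\varepsilon$. -/

import Mathlib

noncomputable section

namespace FrankWolfe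

/-- The Euclidean space `ℝⁿ`. -/
abbrev Vec (n : ℕ) := EuclideanSpace ℝ (Fin n)

variable {n : ℕ}

/-! ### Extended-valued functions and generalized self-concordance -/

/-- The effective domain of `f : ℝⁿ → ℝ ∪ {+∞}`. -/
def dom (f : Vec n → EReal) : Set (Vec n) := {x | f x < ⊤}

/-- The real value of `f` (meaningful on `dom f`). -/
def val (f : Vec n → EReal) (x : Vec n) : ℝ := (f x).toReal

/-- `⟨∇f(x), d⟩`. -/
def slope (f : Vec n → EReal) (x d : Vec n) : ℝ := fderiv ℝ (val f) x d

/-- The Hessian form `⟨∇²f(x) u, v⟩`. -/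
def hess (f : Vec n → EReal) (x u v : Vec n) : ℝ := fderiv ℝ (fderiv ℝ (val f)) x u v

/-- `⟨D³f(x)[w] u, u⟩`, where `D³f(x)[w]` is the derivative of the Hessian in direction `w`. -/
def third (f : Vec n → EReal) (x w u : Vec n) : ℝ :=
  fderiv ℝ (fderiv ℝ (fderiv ℝ (val f))) x w u u

/-- The local norm `‖u‖_{∇²f(x)}`. -/
def hessNorm (f : Vec n → EReal) (x u : Vec n) : ℝ := Real.sqrt (hess f x u u)

/-- `f : ℝⁿ → ℝ ∪ {+∞}` is a closed convex function, three times continuously differentiable on its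
open domain, and `(M, ν)`-generalized self-concordant. -/
structure IsGenSelfConcordant (M ν : ℝ) (f : Vec n → EReal) : Prop where
  ne_bot : ∀ x, f x ≠ ⊥
  isOpen_dom : IsOpen (dom f)
  closed : IsClosed {p : Vec n × ℝ | f p.1 ≤ (p.2 : EReal)}
  convex : Convex ℝ {p : Vec n × ℝ | f p.1 ≤ (p.2 : EReal)}
  contDiff : ContDiffOn ℝ 3 (val f) (dom f)
  bound : ∀ x ∈ dom f, ∀ u w : Vec n,
    |third f x w u| ≤ M * hessNorm f x u ^ 2 * hessNorm f x w ^ (ν - 2) * ‖w‖ ^ (3 - ν)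

/-- The set `s` contains no (full) straight line. -/
def ContainsNoLine (s : Set (Vec n)) : Prop :=
  ∀ x d : Vec n, d ≠ 0 → ∃ r : ℝ, x + r • d ∉ s

/-! ### The constrained problem `min_{x ∈ X} f(x)` -/

/-- A polytope: the convex hull of finitely many points. -/
def IsPolytope (X : Set (Vec n)) : Prop :=
  ∃ s : Set (Vec n), s.Finite ∧ X = convexHull ℝ s

/-- The primal gap `h(x) = f(x) - min_{X} f`. -/
def primalGap (f : Vec n → EReal) (X : Set (Vec n)) (x : Vec n) : ℝ :=
  val f x - sInf (val f '' (X ∩ dom f))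

/-- The Frank-Wolfe gap `g(x) = max_{v ∈ X} ⟨∇f(x), x - v⟩`. -/
def fwGap (f : Vec n → EReal) (X : Set (Vec n)) (x : Vec n) : ℝ :=
  sSup ((fun v => slope f x (x - v)) '' X)

/-- `w(x, S) = max_{u ∈ S, v ∈ X} ⟨∇f(x), u - v⟩`. -/
def strongGap (f : Vec n → EReal) (X : Set (Vec n)) (x : Vec n) (S : Finset (Vec n)) : ℝ :=
  sSup ((fun p : Vec n × Vec n => slope f x (p.1 - p.2)) '' ((S : Set (Vec n)) ×ˢ X))

/-- The initial level set `{x ∈ X ∩ dom f | f(x) ≤ f(x₀)}`. -/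
def levelSet (f : Vec n → EReal) (X : Set (Vec n)) (x₀ : Vec n) : Set (Vec n) :=
  {x | x ∈ X ∩ dom f ∧ f x ≤ f x₀}

/-- The set of the Rayleigh quotients `‖d‖²_{∇²f(u)} / ‖d‖²` for `u ∈ C` and `d ≠ 0`. -/
def curvatures (f : Vec n → EReal) (C : Set (Vec n)) : Set ℝ :=
  {r | ∃ u ∈ C, ∃ d : Vec n, d ≠ 0 ∧ r = hess f u d d / ‖d‖ ^ 2}

/-- The smoothness constant of `f` over `C`. -/
def smoothConst (f : Vec n → EReal) (C : Set (Vec n)) : ℝ := sSup (curvatures f C)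

/-- The strong convexity constant of `f` over `C`. -/
def strongConst (f : Vec n → EReal) (C : Set (Vec n)) : ℝ := sInf (curvatures f C)

/-! ### Pyramidal width -/

/-- The finitely supported weights `c` express `x` as a proper convex combination, that is, with
positive weights on all points of the support of `c`. -/
def IsProperConvexComb (c : Vec n →₀ ℝ) (x : Vec n) : Prop :=
  (∀ y ∈ c.support, 0 < c y) ∧ (c.sum fun _ r => r) = 1 ∧ (c.sum fun y r => r • y) = x

/-- The pyramidal width of a finite set `A` of atoms (Lacoste-Julien and Jaggi): the infimum, over
the faces `K` of `conv A`, the base points `x ∈ K`, the nonzero directions `r` in the cone spanned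
by `K - x`, and the sets `S ⊆ K ∩ A` of which `x` is a proper convex combination, of the width
`max_{s ∈ K ∩ A, v ∈ S} ⟨r / ‖r‖, s - v⟩`. (The faces of a polytope are its exposed faces, and the
polytope itself is one of them.) -/
def pyramidalWidth (A : Set (Vec n)) : ℝ :=
  sInf {δ | ∃ K : Set (Vec n), IsExposed ℝ (convexHull ℝ A) K ∧
    ∃ x ∈ K, ∃ r : Vec n, r ≠ 0 ∧ (∃ y ∈ K, ∃ b : ℝ, 0 ≤ b ∧ r = b • (y - x)) ∧
    ∃ c : Vec n →₀ ℝ, (c.support : Set (Vec n)) ⊆ K ∩ A ∧ IsProperConvexComb c x ∧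
      δ = sSup ((fun p : Vec n × Vec n => inner ℝ r (p.1 - p.2) / ‖r‖) ''
        ((K ∩ A) ×ˢ (c.support : Set (Vec n))))}

/-! ### Backtracking line search -/

/-- The step size tried with the smoothness estimate `M`. If `⟨∇f(x), d⟩ = 0` it is `0`, also for
`d = 0`. -/
def stepSize (f : Vec n → EReal) (x d : Vec n) (γmax M : ℝ) : ℝ :=
  min (-slope f x d / (M * ‖d‖ ^ 2)) γmax

/-- The exit test of the line search for the smoothness estimate `M`. -/
def Accepts (f : Vec n → EReal) (x d : Vec n) (γmax M : ℝ) : Prop :=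
  x + stepSize f x d γmax M • d ∈ dom f ∧
  val f (x + stepSize f x d γmax M • d) - val f x ≤
    M * stepSize f x d γmax M ^ 2 / 2 * ‖d‖ ^ 2 + stepSize f x d γmax M * slope f x d

/-- Admissible initial estimates `M` of the line search: `M ∈ [η Lprev, Lprev]` for some choice of
`0 < η ≤ 1`. -/
def IsInitialEstimate (Lprev M : ℝ) : Prop :=
  ∃ η : ℝ, 0 < η ∧ η ≤ 1 ∧ η * Lprev ≤ M ∧ M ≤ Lprev

/-- `(γ, L)` is an output of the backtracking line search with factor `τ`: from an admissible
initial estimate `M`, the estimate is multiplied by `τ` until the exit test first holds. -/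
def IsBacktrack (f : Vec n → EReal) (x d : Vec n) (τ Lprev γmax γ L : ℝ) : Prop :=
  ∃ M : ℝ, IsInitialEstimate Lprev M ∧ ∃ k : ℕ,
    (∀ j < k, ¬ Accepts f x d γmax (τ ^ j * M)) ∧ Accepts f x d γmax (τ ^ k * M) ∧
    L = τ ^ k * M ∧ γ = stepSize f x d γmax L

/-! ### Away-step Frank-Wolfe -/

/-- The choice of the direction at the point `x` with weights `c` (whose support is the active
set): `v` is a vertex of `X` returned by the linear minimization oracle, `a` an away vertex, `d`
and `γmax` the direction and the maximal step size. -/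
structure IsDirection (f : Vec n → EReal) (X : Set (Vec n)) (x : Vec n) (c : Vec n →₀ ℝ)
    (v a d : Vec n) (γmax : ℝ) : Prop where
  vertex : v ∈ X.extremePoints ℝ
  argmin : ∀ y ∈ X, slope f x v ≤ slope f x y
  active : a ∈ c.support
  argmax : ∀ y ∈ c.support, slope f x y ≤ slope f x a
  fwStep : slope f x (a - x) ≤ slope f x (x - v) → d = v - x ∧ γmax = 1
  awayStep : slope f x (x - v) < slope f x (a - x) → d = x - a ∧ γmax = c a / (1 - c a)

/-- The quantities computed by the algorithm. The active set at iteration `t` is the support of the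
weights `wt t`. The entry `L t` is the smoothness estimate with which iteration `t` starts, so
`L 0` is the initial estimate and `L (t + 1)` the estimate returned by iteration `t`. -/
structure Trace (n : ℕ) where
  x : ℕ → Vec n
  wt : ℕ → (Vec n →₀ ℝ)
  v : ℕ → Vec n
  a : ℕ → Vec n
  d : ℕ → Vec n
  γmax : ℕ → ℝ
  γ : ℕ → ℝ
  L : ℕ → ℝ

/-- Iteration `t` is an away step. -/
def Trace.IsAway (R : Trace n) (f : Vec n → EReal) (t : ℕ) : Prop :=
  slope f (R.x t) (R.x t - R.v t) < slope f (R.x t) (R.a t - R.x t)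

/-- Iteration `t` is an away step of maximal length. -/
def Trace.IsDrop (R : Trace n) (f : Vec n → EReal) (t : ℕ) : Prop :=
  R.IsAway f t ∧ R.γ t = R.γmax t

/-- The first `N` iterations recorded in `R` are iterations of Away-step Frank-Wolfe with
backtracking, started at `x₀` with the smoothness estimate `Linit`. -/
structure IsAFWRun (f : Vec n → EReal) (X : Set (Vec n)) (x₀ : Vec n) (Linit τ : ℝ)
    (N : ℕ) (R : Trace n) : Prop where
  x_zero : R.x 0 = x₀
  wt_zero : R.wt 0 = Finsupp.single x₀ 1
  L_zero : R.L 0 = Linit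
  direction : ∀ t < N, IsDirection f X (R.x t) (R.wt t) (R.v t) (R.a t) (R.d t) (R.γmax t)
  backtrack : ∀ t < N,
    IsBacktrack f (R.x t) (R.d t) τ (R.L t) (R.γmax t) (R.γ t) (R.L (t + 1))
  x_succ : ∀ t < N, R.x (t + 1) = R.x t + R.γ t • R.d t
  wt_succ_fw : ∀ t < N, ¬ R.IsAway f t →
    R.wt (t + 1) = (1 - R.γ t) • R.wt t + Finsupp.single (R.v t) (R.γ t)
  wt_succ_away : ∀ t < N, R.IsAway f t →
    R.wt (t + 1) = (1 + R.γ t) • R.wt t - Finsupp.single (R.a t) (R.γ t)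

/-! ### The constants of the rate -/

/-- `L̃ = max {τ L_f, Linit}`, with `L_f` the smoothness constant over the initial level set. -/
def Ltilde (f : Vec n → EReal) (X : Set (Vec n)) (x₀ : Vec n) (Linit τ : ℝ) : ℝ :=
  max (τ * smoothConst f (levelSet f X x₀)) Linit

/-- The pyramidal width of the set of all possible atoms of the algorithm started at `x₀`: the
vertices of `X` and `x₀`. If `x₀` is a vertex of `X`, this is the pyramidal width of `X`. -/
def atomWidth (X : Set (Vec n)) (x₀ : Vec n) : ℝ :=
  pyramidalWidth (insert x₀ (X.extremePoints ℝ))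

/-- The contraction factor `1 - μ / (4 L̃) * (δ / D)²`. -/
def rate (f : Vec n → EReal) (X : Set (Vec n)) (x₀ : Vec n) (Linit τ : ℝ) : ℝ :=
  1 - strongConst f (levelSet f X x₀) / (4 * Ltilde f X x₀ Linit τ) *
    (atomWidth X x₀ / Metric.diam X) ^ 2

/-- If the algorithm starts at a vertex, the width in the rate is the pyramidal width of `X`. -/
theorem atomWidth_of_vertex {X : Set (Vec n)} {x₀ : Vec n} (h : x₀ ∈ X.extremePoints ℝ) :
    atomWidth X x₀ = pyramidalWidth (X.extremePoints ℝ) := by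
  rw [atomWidth, Set.insert_eq_of_mem h]

end FrankWolfe

end

/-! Write `h` for the primal gap, `w` for the strong gap, `q = -⟨∇f(x), d⟩`, and call an away step
of maximal length a drop step. All iterates stay in the initial level set, which is compact, convex
and contained in `dom f`, so curvature there lies between `μ` and `L_f`.

Line search. Along a step tried with `L ≥ L_f`, the quadratic upper bound keeps `f` below `f(x₀)`,
so the segment never leaves the level set and the test succeeds (`accepts_of_smoothConst_le`). Hence
backtracking terminates and every estimate is at most `L̃` (`IsBacktrack.spec`).

One step. Acceptance gives a decrease of at least `γ q / 2`, and the choice of direction gives `w ≤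
2 q`. If the step is not truncated, `γ = q / (L ‖d‖²)` and the decrease is at least `w² / (8 L̃
D²)`. A full Frank-Wolfe step decreases `f` by at least `w / 4` and `h / 2`
(`IsDirection.decrease`). Geometric strong convexity, `2 μ δ² h ≤ w²`
(`IsDirection.primalGap_le_sq`), then contracts `h` by the stated factor at every step other than a
drop step. It rests on `pyramidalWidth_mul_inner_le`: projecting `-∇f(x)` onto the cone spanned by
the atoms minus `x` yields a face and a direction admissible in the pyramidal width.

Counting. A drop step removes an atom and any other step adds at most one, so at least half of the
first `t` steps contract (`exists_primalGap_le`). Conversely the decrease is at most `h`, so `w` is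
at most of order `√h` or `h`; the square root halves the exponent once more, whence `⌊(t-1)/4⌋`.

Logarithmic complexity needs a factor below one, that is `μ > 0` and `δ > 0`. If the Hessian
degenerated in a direction `u`, self-concordance with `ν ≥ 2` and Grönwall's inequality would make
`f` affine along `u`, and closedness would put the whole line in `dom f` (`hess_pos`). Positivity of
`δ` comes from a uniform bound on the coefficients of conic combinations
(`exists_conic_comb_bound`). Finally, among any `|A|` consecutive iterations one is not a drop step.
-/

noncomputable section

namespace FrankWolfe

variable {n : ℕ}

/-! ### Finitely generated cones -/

section Cone

variable {ι E : Type*} [Fintype ι]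

/-- Carathéodory's argument for cones: moving along a linear dependency of the generators in use
until a first coefficient vanishes shrinks the support without changing the sum. -/
theorem exists_conic_comb_linearIndepOn [AddCommGroup E] [Module ℝ E] (g : ι → E) (c : ι → ℝ)
    (hc : ∀ i, 0 ≤ c i) :
    ∃ c' : ι → ℝ, (∀ i, 0 ≤ c' i) ∧ (∀ i, c i = 0 → c' i = 0) ∧
      ∑ i, c' i • g i = ∑ i, c i • g i ∧ LinearIndepOn ℝ g {i | c' i ≠ 0} := by
  classical
  induction hk : (Finset.univ.filter fun i => c i ≠ 0).card using Nat.strong_induction_on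
    generalizing c with
  | _ k ih =>
    by_cases hli : LinearIndepOn ℝ g {i | c i ≠ 0}
    · exact ⟨c, hc, fun _ h => h, rfl, hli⟩
    obtain ⟨l, hl0, hlsum, i₀, hi₀, hli₀⟩ : ∃ l : ι → ℝ, (∀ i, c i = 0 → l i = 0) ∧
        ∑ i, l i • g i = 0 ∧ ∃ i, c i ≠ 0 ∧ 0 < l i := by
      have hset : ({i | c i ≠ 0} : Set ι) = ↑(Finset.univ.filter fun i => c i ≠ 0) := by
        ext; simp
      rw [hset, linearIndepOn_finset_iff] at hli
      push Not at hli
      obtain ⟨l, hl, i, hi, hne⟩ := hli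
      have hsum : ∑ i, (if c i = 0 then 0 else l i) • g i = 0 := by
        rw [← hl, Finset.sum_filter]
        refine Finset.sum_congr rfl fun i _ => ?_
        by_cases h : c i = 0 <;> simp [h]
      have hci : c i ≠ 0 := by simpa using hi
      rcases lt_or_gt_of_ne hne with h | h
      · refine ⟨fun i => -(if c i = 0 then 0 else l i), fun i h => by simp [h], ?_, i, hci, ?_⟩
        · simp only [neg_smul, Finset.sum_neg_distrib, hsum, neg_zero]
        · simpa [hci] using h
      · exact ⟨fun i => if c i = 0 then 0 else l i, fun i h => by simp [h], hsum, i, hci, by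
          simpa [hci] using h⟩
    -- The minimal ratio is the largest multiple of `l` that can be subtracted while all
    -- coefficients stay nonnegative; it cancels the coefficient at `j`.
    obtain ⟨j, hj, hjmin⟩ := Finset.exists_min_image (Finset.univ.filter fun i => 0 < l i)
      (fun i => c i / l i) ⟨i₀, by simpa using hli₀⟩
    simp only [Finset.mem_filter, Finset.mem_univ, true_and] at hj hjmin
    have hcj : c j ≠ 0 := fun h => by rw [hl0 j h] at hj; exact lt_irrefl _ hj
    have ht : 0 ≤ c j / l j := div_nonneg (hc j) hj.le
    set t := c j / l j
    have hnn : ∀ i, 0 ≤ c i - t * l i := fun i => by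
      rcases le_or_gt (l i) 0 with h | h
      · nlinarith [hc i, mul_nonneg ht (neg_nonneg.2 h)]
      · have := (le_div_iff₀ h).1 (hjmin i h)
        linarith
    have hzero : ∀ i, c i = 0 → c i - t * l i = 0 := fun i h => by rw [hl0 i h, h]; simp
    have hj0 : c j - t * l j = 0 := by
      simp only [t]; field_simp; simp
    obtain ⟨c', h1, h2, h3, h4⟩ := ih _ (by
      rw [← hk]
      refine Finset.card_lt_card (Finset.ssubset_iff_subset_ne.2 ⟨fun i => ?_, fun h => ?_⟩)
      · simp only [Finset.mem_filter, Finset.mem_univ, true_and]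
        exact mt (hzero i)
      · have : j ∈ Finset.univ.filter fun i => c i - t * l i ≠ 0 := by
          rw [h]; simpa using hcj
        simp [hj0] at this) (fun i => c i - t * l i) hnn rfl
    refine ⟨c', h1, fun i h => h2 i (hzero i h), h3.trans ?_, h4⟩
    simp only [sub_smul, Finset.sum_sub_distrib, mul_smul]
    rw [← Finset.smul_sum, hlsum, smul_zero, sub_zero]

theorem exists_sum_abs_le_of_linearIndepOn [NormedAddCommGroup E] [NormedSpace ℝ E]
    (g : ι → E) (s : Set ι) (hs : LinearIndepOn ℝ g s) :
    ∃ C : ℝ, 0 ≤ C ∧ ∀ c : ι → ℝ, (∀ i ∉ s, c i = 0) → ∑ i, |c i| ≤ C * ‖∑ i, c i • g i‖ := by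
  classical
  have hker : LinearMap.ker (Fintype.linearCombination ℝ fun i : s => g i) = ⊥ :=
    by
    rw [LinearMap.ker_eq_bot]
    exact linearIndependent_iff_injective_fintypeLinearCombination.1 hs
  obtain ⟨K, -, hK⟩ := LinearMap.exists_antilipschitzWith _ hker
  refine ⟨Fintype.card ι * K, by positivity, fun c hc => ?_⟩
  have hsum : Fintype.linearCombination ℝ (fun i : s => g i) (fun i : s => c i) =
      ∑ i, c i • g i := by
    rw [Fintype.linearCombination_apply]
    refine Fintype.sum_of_injective (fun i : s => (i : ι)) Subtype.val_injective _ _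
      (fun i hi => ?_) fun _ => rfl
    rw [hc i (by simpa using hi), zero_smul]
  have hle : ∀ i, |c i| ≤ K * ‖∑ i, c i • g i‖ := fun i => by
    by_cases hi : i ∈ s
    · have h1 := hK.le_mul_dist (fun i : s => c i) 0
      rw [map_zero, dist_zero_right, dist_zero_right, hsum] at h1
      exact (norm_le_pi_norm (fun i : s => c i) ⟨i, hi⟩).trans h1
    · rw [hc i hi, abs_zero]; positivity
  calc ∑ i, |c i| ≤ ∑ _i : ι, K * ‖∑ i, c i • g i‖ := Finset.sum_le_sum fun i _ => hle i
    _ = _ := by simp [mul_assoc]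

/-- On a linearly independent subfamily the coefficients are bounded linearly by the norm of the
sum. There are only finitely many subfamilies, so after the Carathéodory reduction one constant
serves all. This gives both the compactness behind the conic projection and the positivity of the
pyramidal width. -/
theorem exists_conic_comb_bound [NormedAddCommGroup E] [NormedSpace ℝ E] (g : ι → E) :
    ∃ C : ℝ, 0 ≤ C ∧ ∀ c : ι → ℝ, (∀ i, 0 ≤ c i) → ∃ c' : ι → ℝ, (∀ i, 0 ≤ c' i) ∧
      (∀ i, c i = 0 → c' i = 0) ∧ ∑ i, c' i • g i = ∑ i, c i • g i ∧
      ∑ i, c' i ≤ C * ‖∑ i, c i • g i‖ := by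
  classical
  have hex : ∀ s : Set ι, ∃ C : ℝ, 0 ≤ C ∧ (LinearIndepOn ℝ g s → ∀ c : ι → ℝ,
      (∀ i ∉ s, c i = 0) → ∑ i, |c i| ≤ C * ‖∑ i, c i • g i‖) := fun s => by
    by_cases hs : LinearIndepOn ℝ g s
    · obtain ⟨C, h0, h⟩ := exists_sum_abs_le_of_linearIndepOn g s hs
      exact ⟨C, h0, fun _ => h⟩
    · exact ⟨0, le_rfl, fun h => absurd h hs⟩
  choose C hC0 hC using hex
  refine ⟨∑ s, C s, Finset.sum_nonneg fun s _ => hC0 s, fun c hc => ?_⟩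
  obtain ⟨c', h1, h2, h3, h4⟩ := exists_conic_comb_linearIndepOn g c hc
  refine ⟨c', h1, h2, h3, ?_⟩
  have := hC _ h4 c' (fun i hi => by simpa using hi)
  rw [h3] at this
  calc ∑ i, c' i = ∑ i, |c' i| := Finset.sum_congr rfl fun i _ => (abs_of_nonneg (h1 i)).symm
    _ ≤ _ := this
    _ ≤ _ := by
      gcongr
      exact Finset.single_le_sum (fun s _ => hC0 s) (Finset.mem_univ _)

/-- The metric projection onto a finitely generated cone, with its variational
characterization. -/
theorem exists_conic_projection [NormedAddCommGroup E] [InnerProductSpace ℝ E] (g : ι → E)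
    (r : E) :
    ∃ c : ι → ℝ, (∀ i, 0 ≤ c i) ∧ (∀ i, inner ℝ (r - ∑ j, c j • g j) (g i) ≤ 0) ∧
      inner ℝ (r - ∑ j, c j • g j) (∑ j, c j • g j) = 0 := by
  obtain ⟨C, hC0, hC⟩ := exists_conic_comb_bound g
  -- Every point of the cone of norm at most `2 ‖r‖` has coefficients in `Q`; any other point of the
  -- cone is farther from `r` than `0` is. So minimizing over the compact set `Q` is enough.
  set Q : Set (ι → ℝ) := {c | (∀ i, 0 ≤ c i) ∧ ∑ i, c i ≤ C * (2 * ‖r‖)} with hQ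
  have hQc : IsCompact Q := by
    refine IsCompact.of_isClosed_subset (isCompact_univ_pi (s := fun _ : ι =>
      Set.Icc (0 : ℝ) (C * (2 * ‖r‖))) fun _ => isCompact_Icc) ?_ ?_
    · refine IsClosed.inter (s₁ := {c : ι → ℝ | ∀ i, 0 ≤ c i}) ?_ ?_
      · simp only [Set.ofPred_forall]
        exact isClosed_iInter fun i => isClosed_le continuous_const (continuous_apply i)
      · exact isClosed_le (f := fun c : ι → ℝ => ∑ i, c i) (by fun_prop) continuous_const
    · intro c hc i _
      exact ⟨hc.1 i, (Finset.single_le_sum (fun j _ => hc.1 j) (Finset.mem_univ i)).trans hc.2⟩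
  have h0Q : (0 : ι → ℝ) ∈ Q := ⟨fun _ => le_rfl, by simp; positivity⟩
  obtain ⟨c, hcQ, hmin⟩ := hQc.exists_isMinOn ⟨0, h0Q⟩
    (f := fun c => ‖r - ∑ j, c j • g j‖) (by fun_prop)
  have hglob : ∀ e : ι → ℝ, (∀ i, 0 ≤ e i) → ‖r - ∑ j, c j • g j‖ ≤ ‖r - ∑ j, e j • g j‖ := by
    intro e he
    rcases le_or_gt ‖∑ j, e j • g j‖ (2 * ‖r‖) with h | h
    · obtain ⟨e', h1, -, h3, h4⟩ := hC e he
      rw [← h3]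
      exact hmin (⟨h1, h4.trans (by gcongr)⟩ : e' ∈ Q)
    · have h1 : ‖r - ∑ j, c j • g j‖ ≤ ‖r‖ := by simpa using hmin h0Q
      have h2 := norm_sub_norm_le (∑ j, e j • g j) r
      rw [norm_sub_rev] at h2
      linarith
  set K : Set E := {z | ∃ e : ι → ℝ, (∀ i, 0 ≤ e i) ∧ z = ∑ j, e j • g j} with hK
  have hKconv : Convex ℝ K := by
    rintro _ ⟨e₁, h1, rfl⟩ _ ⟨e₂, h2, rfl⟩ a b ha hb -
    refine ⟨fun i => a * e₁ i + b * e₂ i, fun i => add_nonneg (mul_nonneg ha (h1 i))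
      (mul_nonneg hb (h2 i)), ?_⟩
    simp only [add_smul, mul_smul, Finset.sum_add_distrib, Finset.smul_sum]
  have hmem : ∑ j, c j • g j ∈ K := ⟨c, hcQ.1, rfl⟩
  have hinf : ‖r - ∑ j, c j • g j‖ = ⨅ w : K, ‖r - w‖ := by
    have : Nonempty K := ⟨⟨_, hmem⟩⟩
    refine le_antisymm (le_ciInf ?_) (ciInf_le (f := fun w : K => ‖r - w‖)
      ⟨0, ?_⟩ (⟨_, hmem⟩ : K))
    · rintro ⟨_, e, he, rfl⟩
      exact hglob e he
    · rintro _ ⟨w, rfl⟩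
      exact norm_nonneg _
  have hvar := (norm_eq_iInf_iff_real_inner_le_zero hKconv hmem).1 hinf
  set p := ∑ j, c j • g j with hp
  -- The variational inequality is tested at `p + g i` for the polar condition, and at `2 p` and `0`
  -- for the two signs of the orthogonality relation.
  have hadd : ∀ i, p + g i ∈ K := fun i => by
    classical
    refine ⟨fun j => c j + if j = i then 1 else 0, fun j => ?_, ?_⟩
    · have := hcQ.1 j
      dsimp only
      split_ifs <;> linarith
    · simp [add_smul, Finset.sum_add_distrib, hp]
  have h2p : (2 : ℝ) • p ∈ K := ⟨fun j => 2 * c j, fun j => mul_nonneg zero_le_two (hcQ.1 j), by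
    simp only [mul_smul, hp, Finset.smul_sum]⟩
  have h0 : (0 : E) ∈ K := ⟨0, fun _ => le_rfl, by simp⟩
  refine ⟨c, hcQ.1, fun i => by simpa using hvar _ (hadd i), ?_⟩
  have ha := hvar _ h2p
  have hb := hvar _ h0
  rw [two_smul, add_sub_cancel_right] at ha
  rw [zero_sub, inner_neg_right] at hb
  exact le_antisymm ha (by linarith)

end Cone

/-! ### Pyramidal width -/

/-- The set of directional widths whose infimum is the pyramidal width. -/
def pyramidalWidths (A : Set (Vec n)) : Set ℝ :=
  {δ | ∃ K : Set (Vec n), IsExposed ℝ (convexHull ℝ A) K ∧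
    ∃ x ∈ K, ∃ r : Vec n, r ≠ 0 ∧ (∃ y ∈ K, ∃ b : ℝ, 0 ≤ b ∧ r = b • (y - x)) ∧
    ∃ c : Vec n →₀ ℝ, (c.support : Set (Vec n)) ⊆ K ∩ A ∧ IsProperConvexComb c x ∧
      δ = sSup ((fun p : Vec n × Vec n => inner ℝ r (p.1 - p.2) / ‖r‖) ''
        ((K ∩ A) ×ˢ (c.support : Set (Vec n))))}

/-- A face is the closed hull of its extreme points by Krein-Milman, and these are extreme in `conv
A`, hence atoms. -/
theorem IsExposed.subset_convexHull_inter {A K : Set (Vec n)} (hA : A.Finite)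
    (hK : IsExposed ℝ (convexHull ℝ A) K) : K ⊆ convexHull ℝ (K ∩ A) := by
  have hcomp : IsCompact K := hK.isCompact (hA.isCompact_convexHull ℝ)
  have hconv : Convex ℝ K := hK.convex (convex_convexHull ℝ A)
  have hsub : K.extremePoints ℝ ⊆ K ∩ A := fun z hz =>
    ⟨hz.1, extremePoints_convexHull_subset (hK.isExtreme.extremePoints_subset_extremePoints hz)⟩
  exact (closure_convexHull_extremePoints hcomp hconv).symm.subset.trans
    (closure_minimal (convexHull_mono hsub)
      ((hA.subset Set.inter_subset_right).isClosed_convexHull ℝ))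

theorem sum_coe_of_subset {A : Set (Vec n)} [Fintype A] {F : Type*} [AddCommMonoid F]
    {T : Finset (Vec n)} (hT : (T : Set (Vec n)) ⊆ A) (φ : Vec n → F)
    (hφ : ∀ s ∈ A, s ∉ T → φ s = 0) : ∑ s : A, φ s = ∑ s ∈ T, φ s := by
  classical
  rw [Finset.sum_set_coe]
  exact (Finset.sum_subset (fun s hs => Set.mem_toFinset.2 (hT hs))
    fun s hs => hφ s (Set.mem_toFinset.1 hs)).symm

theorem exists_weights_of_mem_convexHull {A B : Set (Vec n)} [Fintype A] (hBA : B ⊆ A) {y : Vec n}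
    (hy : y ∈ convexHull ℝ B) : ∃ α : A → ℝ, (∀ s, 0 ≤ α s) ∧ (∀ s : A, (s : Vec n) ∉ B → α s = 0) ∧
      ∑ s, α s = 1 ∧ ∑ s : A, α s • (s : Vec n) = y := by
  classical
  have hB : B.Finite := A.toFinite.subset hBA
  rw [← hB.coe_toFinset, Finset.mem_convexHull'] at hy
  obtain ⟨w, h0, h1, h2⟩ := hy
  have hT : (hB.toFinset : Set (Vec n)) ⊆ A := by simpa using hBA
  refine ⟨fun s => if (s : Vec n) ∈ B then w s else 0, fun s => ?_, fun s hs => by simp [hs], ?_, ?_⟩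
  · dsimp only
    split_ifs with h
    · exact h0 _ (by simpa using h)
    · exact le_rfl
  · rw [sum_coe_of_subset hT (fun s => if s ∈ B then w s else 0) (by simp +contextual), ← h1]
    exact Finset.sum_congr rfl fun s hs => if_pos (by simpa using hs)
  · rw [sum_coe_of_subset hT (fun s => (if s ∈ B then w s else 0) • s) (by simp +contextual), ← h2]
    exact Finset.sum_congr rfl fun s hs => by rw [if_pos (by simpa using hs)]

theorem IsProperConvexComb.exists_weights {A : Set (Vec n)} [Fintype A] {c : Vec n →₀ ℝ}
    {x : Vec n} (hc : IsProperConvexComb c x) (hcA : (c.support : Set (Vec n)) ⊆ A) :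
    (∀ s : A, 0 ≤ c s) ∧ ∑ s : A, c s = 1 ∧ ∑ s : A, c s • (s : Vec n) = x := by
  obtain ⟨h0, h1, h2⟩ := hc
  refine ⟨fun s => ?_, ?_, ?_⟩
  · by_cases h : (s : Vec n) ∈ c.support
    · exact (h0 _ h).le
    · exact (Finsupp.notMem_support_iff.1 h).ge
  · rw [sum_coe_of_subset hcA (fun s => c s) fun s _ hs => Finsupp.notMem_support_iff.1 hs]
    exact h1
  · rw [sum_coe_of_subset hcA (fun s => c s • s) fun s _ hs => by
      rw [Finsupp.notMem_support_iff.1 hs, zero_smul]]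
    exact h2

/-- Every directional width in the definition of the pyramidal width is bounded below by a
positive constant. -/
theorem exists_one_le_mul_of_mem_pyramidalWidths {A : Set (Vec n)} (hA : A.Finite) :
    ∃ C : ℝ, 0 < C ∧ ∀ δ ∈ pyramidalWidths A, 1 ≤ C * δ := by
  have := hA.fintype
  obtain ⟨C, hC0, hC⟩ := exists_conic_comb_bound (fun p : A × A => (p.1 - p.2 : Vec n))
  refine ⟨C + 1, by positivity, ?_⟩
  rintro δ ⟨K, hK, x, hx, r, hr, ⟨y, hy, b, hb, rfl⟩, c, hcK, hc, rfl⟩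
  set r := b • (y - x) with hrdef
  set m := sSup ((fun p : Vec n × Vec n => inner ℝ r (p.1 - p.2) / ‖r‖) ''
        ((K ∩ A) ×ˢ (c.support : Set (Vec n)))) with hm
  have hrpos : 0 < ‖r‖ := norm_pos_iff.2 hr
  have hle : ∀ s ∈ K ∩ A, ∀ v ∈ c.support, inner ℝ r (s - v) ≤ m * ‖r‖ := fun s hs v hv => by
    rw [← div_le_iff₀ hrpos]
    refine le_csSup (Set.Finite.bddAbove ?_) ⟨(s, v), ⟨hs, hv⟩, rfl⟩
    exact ((hA.subset Set.inter_subset_right).prod c.support.finite_toSet).image _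
  obtain ⟨α, hα0, hαK, hα1, hαy⟩ := exists_weights_of_mem_convexHull (A := A)
    Set.inter_subset_right (IsExposed.subset_convexHull_inter hA hK hy)
  obtain ⟨hc0, hc1, hcx⟩ := hc.exists_weights (hcK.trans Set.inter_subset_right)
  -- With `y = ∑ α s • s` and `x = ∑ c v • v`, the direction `r` is the conic combination of the
  -- differences `s - v` with coefficients `b α s c v`. The reduced coefficients `e` have sum at
  -- most `C ‖r‖` and use only pairs with `s ∈ K` and `v` in the support of `c`.
  obtain ⟨e, he0, hesupp, hesum, hebd⟩ := hC (fun p => b * (α p.1 * c p.2)) fun p =>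
    mul_nonneg hb (mul_nonneg (hα0 _) (hc0 _))
  have hcomb : ∑ p : A × A, (b * (α p.1 * c p.2)) • (p.1 - p.2 : Vec n) = r := by
    rw [hrdef, ← hαy, ← hcx]
    simp only [mul_smul, ← Finset.smul_sum]
    congr 1
    simp only [smul_sub, Finset.sum_sub_distrib, Fintype.sum_prod_type]
    congr 1
    · refine Finset.sum_congr rfl fun s _ => ?_
      rw [← Finset.smul_sum, ← Finset.sum_smul, hc1, one_smul]
    · simp only [← Finset.smul_sum]
      rw [← Finset.sum_smul, hα1, one_smul]
  rw [hcomb] at hesum hebd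
  -- Pairing `r` with its own expansion bounds each term by the width `m`, so `‖r‖² ≤ C ‖r‖ · m
  -- ‖r‖`.
  have hsq : ‖r‖ ^ 2 ≤ (∑ p, e p) * (m * ‖r‖) := by
    rw [← real_inner_self_eq_norm_sq]
    nth_rw 2 [← hesum]
    rw [inner_sum, Finset.sum_mul]
    refine Finset.sum_le_sum fun p _ => ?_
    rw [inner_smul_right]
    by_cases hp : α p.1 = 0 ∨ c p.2 = 0
    · rw [hesupp p (by rcases hp with h | h <;> simp [h])]; simp
    · push Not at hp
      refine mul_le_mul_of_nonneg_left (hle _ ?_ _ ?_) (he0 p)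
      · by_contra h
        exact hp.1 (hαK _ h)
      · exact Finsupp.mem_support_iff.2 hp.2
  have hesum0 : 0 ≤ ∑ p, e p := Finset.sum_nonneg fun p _ => he0 p
  have hmpos : 0 < m := by
    by_contra h
    have : (∑ p, e p) * (m * ‖r‖) ≤ 0 := mul_nonpos_of_nonneg_of_nonpos hesum0
      (mul_nonpos_of_nonpos_of_nonneg (not_lt.1 h) hrpos.le)
    nlinarith [sq_pos_of_pos hrpos]
  have h1 : ‖r‖ ^ 2 * 1 ≤ ‖r‖ ^ 2 * (C * m) := by
    calc ‖r‖ ^ 2 * 1 ≤ (∑ p, e p) * (m * ‖r‖) := by rw [mul_one]; exact hsq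
      _ ≤ (C * ‖r‖) * (m * ‖r‖) := by gcongr
      _ = _ := by ring
  have h2 := le_of_mul_le_mul_left h1 (by positivity)
  linarith

theorem pyramidalWidth_nonneg {A : Set (Vec n)} (hA : A.Finite) : 0 ≤ pyramidalWidth A := by
  obtain ⟨C, hC, h⟩ := exists_one_le_mul_of_mem_pyramidalWidths hA
  refine Real.sInf_nonneg fun δ hδ => ?_
  have := h δ hδ
  by_contra! hneg
  nlinarith

theorem pyramidalWidth_le_of_mem {A : Set (Vec n)} (hA : A.Finite) {δ : ℝ}
    (hδ : δ ∈ pyramidalWidths A) : pyramidalWidth A ≤ δ := by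
  obtain ⟨C, hC, h⟩ := exists_one_le_mul_of_mem_pyramidalWidths hA
  refine csInf_le ⟨0, fun δ hδ => ?_⟩ hδ
  have := h δ hδ
  by_contra! hneg
  nlinarith

theorem isProperConvexComb_single (x : Vec n) : IsProperConvexComb (Finsupp.single x 1) x := by
  refine ⟨fun y hy => ?_, by simp, by simp⟩
  have := Finsupp.support_single_subset hy
  simp_all

theorem pyramidalWidth_pos {A : Set (Vec n)} (hA : A.Finite) (hA2 : A.Nontrivial) :
    0 < pyramidalWidth A := by
  obtain ⟨C, hC, h⟩ := exists_one_le_mul_of_mem_pyramidalWidths hA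
  obtain ⟨x, hx, y, hy, hxy⟩ := hA2
  have hne : (pyramidalWidths A).Nonempty := by
    refine ⟨_, convexHull ℝ A, IsExposed.refl _, x, subset_convexHull ℝ A hx, y - x,
      sub_ne_zero.2 hxy.symm, ⟨y, subset_convexHull ℝ A hy, 1, zero_le_one, by simp⟩,
      Finsupp.single x 1, ?_, isProperConvexComb_single x, rfl⟩
    intro z hz
    have := Finsupp.support_single_subset hz
    simp only [Finset.mem_singleton] at this
    exact this ▸ ⟨subset_convexHull ℝ A hx, hx⟩
  refine lt_of_lt_of_le (one_div_pos.2 hC) (le_csInf hne fun δ hδ => ?_)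
  rw [div_le_iff₀' hC]
  exact h δ hδ

/-- The pyramidal width compares the gap over the atoms and the active set of `x` with the slope
towards any other point (Lacoste-Julien and Jaggi). -/
theorem pyramidalWidth_mul_inner_le {A : Set (Vec n)} (hA : A.Finite) {c : Vec n →₀ ℝ}
    {x y ρ : Vec n} (hc : IsProperConvexComb c x) (hcA : (c.support : Set (Vec n)) ⊆ A)
    (hy : y ∈ convexHull ℝ A) {m : ℝ} (hm0 : 0 ≤ m)
    (hm : ∀ s ∈ A, ∀ v ∈ c.support, inner ℝ ρ (s - v) ≤ m) :
    pyramidalWidth A * inner ℝ ρ (y - x) ≤ m * ‖y - x‖ := by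
  have := hA.fintype
  have hw0 := pyramidalWidth_nonneg hA
  -- `p` is the projection of `ρ` onto the cone of feasible directions at `x`; the residual `ρ - p`
  -- is nonpositive on all of them and orthogonal to `p`.
  obtain ⟨e, he0, he, hep⟩ := exists_conic_projection (fun a : A => (a - x : Vec n)) ρ
  set p := ∑ a : A, e a • (a - x : Vec n) with hp
  have hhull : ∀ z ∈ convexHull ℝ A, inner ℝ (ρ - p) (z - x) ≤ 0 := by
    have hcv : Convex ℝ {z : Vec n | inner ℝ (ρ - p) z ≤ inner ℝ (ρ - p) x} :=
      convex_halfSpace_le (innerₛₗ ℝ (ρ - p)).isLinear _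
    intro z hz
    rw [inner_sub_right, sub_nonpos]
    refine convexHull_min (fun a ha => ?_) hcv hz
    have := he ⟨a, ha⟩
    rwa [inner_sub_right, sub_nonpos] at this
  have hsplit : ∀ z, inner ℝ ρ z = inner ℝ p z + inner ℝ (ρ - p) z := fun z => by
    rw [inner_sub_left]; ring
  have hyx := hhull y hy
  by_cases hp0 : p = 0
  · have : inner ℝ ρ (y - x) ≤ 0 := by rw [hsplit, hp0, inner_zero_left]; rw [hp0] at hyx; linarith
    exact (mul_nonpos_of_nonneg_of_nonpos hw0 this).trans (by positivity)
  have hppos : 0 < ‖p‖ := norm_pos_iff.2 hp0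
  -- The face on which the residual is maximal. It contains `x`, and `p` turns out to be a direction
  -- admissible at `x` within this face.
  set K := ((innerSL ℝ (ρ - p)).toExposed (convexHull ℝ A)) with hK
  have hKmem : ∀ z ∈ convexHull ℝ A, inner ℝ (ρ - p) (z - x) = 0 → z ∈ K := by
    intro z hz hzx
    refine ⟨hz, fun u hu => ?_⟩
    have h1 := hhull u hu
    rw [inner_sub_right] at h1 hzx
    change inner ℝ (ρ - p) u ≤ inner ℝ (ρ - p) z
    linarith
  obtain ⟨hc0, hc1, hcx⟩ := hc.exists_weights hcA
  have hxA : x ∈ convexHull ℝ A := by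
    rw [← hcx]
    exact (convex_convexHull ℝ A).sum_mem (fun s _ => hc0 s) hc1
      fun s _ => subset_convexHull ℝ A s.2
  have hxK : x ∈ K := hKmem x hxA (by simp)
  -- The weighted sum of the nonpositive numbers `⟨ρ - p, s - x⟩` is zero, so each one with positive
  -- weight vanishes.
  have hsuppK : ∀ v ∈ c.support, inner ℝ (ρ - p) (v - x) = 0 := by
    have hsum : ∑ s : A, c s * inner ℝ (ρ - p) (s - x : Vec n) = 0 := by
      simp only [← inner_smul_right, ← inner_sum, smul_sub, Finset.sum_sub_distrib, hcx,
        ← Finset.sum_smul, hc1, one_smul, sub_self, inner_zero_right]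
    rw [Finset.sum_eq_zero_iff_of_nonpos fun s _ => mul_nonpos_of_nonneg_of_nonpos (hc0 s)
      (he s)] at hsum
    intro v hv
    exact (mul_eq_zero.1 (hsum ⟨v, hcA hv⟩ (Finset.mem_univ _))).resolve_left
      (Finsupp.mem_support_iff.1 hv)
  have hb : 0 < ∑ a, e a := by
    refine lt_of_le_of_ne (Finset.sum_nonneg fun a _ => he0 a) fun h => hp0 ?_
    have := (Finset.sum_eq_zero_iff_of_nonneg fun a _ => he0 a).1 h.symm
    rw [hp]
    exact Finset.sum_eq_zero fun a ha => by rw [this a ha, zero_smul]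
  set b := ∑ a, e a with hbdef
  have hpx : p = b • ((∑ a : A, (b⁻¹ * e a) • (a : Vec n)) - x) := by
    simp only [mul_smul, ← Finset.smul_sum]
    rw [smul_sub, smul_inv_smul₀ hb.ne', hp]
    simp only [smul_sub, Finset.sum_sub_distrib, ← Finset.sum_smul, hbdef]
  have hy' : (∑ a : A, (b⁻¹ * e a) • (a : Vec n)) ∈ convexHull ℝ A := by
    refine (convex_convexHull ℝ A).sum_mem (fun s _ => mul_nonneg (inv_nonneg.2 hb.le) (he0 s)) ?_
      fun s _ => subset_convexHull ℝ A s.2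
    rw [← Finset.mul_sum, inv_mul_cancel₀ hb.ne']
  have hy'K : (∑ a : A, (b⁻¹ * e a) • (a : Vec n)) ∈ K := by
    refine hKmem _ hy' ?_
    rw [hpx, inner_smul_right] at hep
    rw [← hpx] at hep
    exact (mul_eq_zero.1 hep).resolve_left hb.ne'
  have hmemw : _ ∈ pyramidalWidths A := ⟨K, ContinuousLinearMap.toExposed.isExposed, x, hxK, p, hp0,
    ⟨_, hy'K, b, hb.le, hpx⟩, c, fun v hv => ⟨hKmem v (subset_convexHull ℝ A (hcA hv))
      (hsuppK v hv), hcA hv⟩, hc, rfl⟩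
  have hwle : pyramidalWidth A ≤ m / ‖p‖ := by
    refine (pyramidalWidth_le_of_mem hA hmemw).trans (csSup_le ?_ ?_)
    · have hne : c.support.Nonempty := by
        rw [Finsupp.support_nonempty_iff]
        rintro rfl
        simp at hc1
      obtain ⟨v, hv⟩ := hne
      exact ⟨_, (v, v), ⟨⟨hKmem v (subset_convexHull ℝ A (hcA hv)) (hsuppK v hv), hcA hv⟩, hv⟩, rfl⟩
    · rintro _ ⟨⟨s, v⟩, ⟨⟨hsK, hsA⟩, hv⟩, rfl⟩
      refine div_le_div_of_nonneg_right ?_ hppos.le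
      have h1 := hm s hsA v hv
      -- Since `s` lies in the face, passing from `p` to `ρ` can only increase the pairing with `s -
      -- v`.
      have h2 : inner ℝ (ρ - p) v ≤ inner ℝ (ρ - p) s := hsK.2 v (subset_convexHull ℝ A (hcA hv))
      rw [hsplit, inner_sub_right (ρ - p)] at h1
      change inner ℝ p (s - v) ≤ m
      linarith
  rw [le_div_iff₀ hppos] at hwle
  calc pyramidalWidth A * inner ℝ ρ (y - x) ≤ pyramidalWidth A * (‖p‖ * ‖y - x‖) := by
        refine mul_le_mul_of_nonneg_left ?_ hw0
        rw [hsplit]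
        linarith [real_inner_le_norm p (y - x)]
    _ = (pyramidalWidth A * ‖p‖) * ‖y - x‖ := by ring
    _ ≤ m * ‖y - x‖ := by gcongr

/-- The comparison inequality at an atom `x` in the direction `ρ = y - x` of another atom, with
Cauchy-Schwarz bounding the pairings. -/
theorem pyramidalWidth_le_diam {A : Set (Vec n)} (hA : A.Finite) (hA2 : A.Nontrivial) :
    pyramidalWidth A ≤ Metric.diam (convexHull ℝ A) := by
  obtain ⟨x, hx, y, hy, hxy⟩ := hA2
  have hpos : 0 < ‖y - x‖ := norm_pos_iff.2 (sub_ne_zero.2 hxy.symm)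
  have hdiam : ∀ s ∈ A, ∀ v ∈ A, ‖s - v‖ ≤ Metric.diam (convexHull ℝ A) := fun s hs v hv => by
    rw [← dist_eq_norm]
    exact Metric.dist_le_diam_of_mem (hA.isCompact_convexHull ℝ).isBounded
      (subset_convexHull ℝ A hs) (subset_convexHull ℝ A hv)
  have hsupp : ∀ z ∈ (Finsupp.single x (1 : ℝ)).support, z ∈ A := fun z hz => by
    have := Finsupp.support_single_subset hz
    simp only [Finset.mem_singleton] at this
    exact this ▸ hx
  have h := pyramidalWidth_mul_inner_le hA (ρ := y - x) (isProperConvexComb_single x) hsupp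
    (subset_convexHull ℝ A hy) (m := ‖y - x‖ * Metric.diam (convexHull ℝ A)) (by positivity)
    fun s hs v hv => (real_inner_le_norm _ _).trans
      (mul_le_mul_of_nonneg_left (hdiam s hs v (hsupp v hv)) hpos.le)
  rw [real_inner_self_eq_norm_sq] at h
  have : 0 < ‖y - x‖ ^ 2 := by positivity
  nlinarith

/-! ### Second-order Taylor bounds on the line -/

/-- Two monotonicity arguments: `φ' - c s` is antitone, hence so is `φ - φ' 0 s - c s² / 2`. -/
theorem le_taylor_of_deriv2_le {φ φ' φ'' : ℝ → ℝ} {c T : ℝ} (hT : 0 ≤ T)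
    (h1 : ∀ s ∈ Set.Icc 0 T, HasDerivAt φ (φ' s) s)
    (h2 : ∀ s ∈ Set.Icc 0 T, HasDerivAt φ' (φ'' s) s) (hc : ∀ s ∈ Set.Icc 0 T, φ'' s ≤ c) :
    φ T ≤ φ 0 + T * φ' 0 + c * T ^ 2 / 2 := by
  have hsub : interior (Set.Icc 0 T) ⊆ Set.Icc 0 T := interior_subset
  have d1 : ∀ s ∈ Set.Icc 0 T, HasDerivAt (fun s => φ' s - c * s) (φ'' s - c) s := fun s hs => by
    simpa using (h2 s hs).fun_sub ((hasDerivAt_id s).const_mul c)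
  have a1 : AntitoneOn (fun s => φ' s - c * s) (Set.Icc 0 T) :=
    antitoneOn_of_deriv_nonpos (convex_Icc 0 T)
      (fun s hs => (d1 s hs).continuousAt.continuousWithinAt)
      (fun s hs => (d1 s (hsub hs)).differentiableAt.differentiableWithinAt)
      fun s hs => by rw [(d1 s (hsub hs)).deriv]; linarith [hc s (hsub hs)]
  have d2 : ∀ s ∈ Set.Icc 0 T, HasDerivAt (fun s => φ s - φ' 0 * s - c / 2 * s ^ 2)
      (φ' s - φ' 0 - c * s) s := fun s hs => by
    refine (((h1 s hs).sub ((hasDerivAt_id s).const_mul (φ' 0))).sub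
      ((hasDerivAt_pow 2 s).const_mul (c / 2))).congr_deriv ?_
    simp; ring
  have h0 : (0 : ℝ) ∈ Set.Icc 0 T := ⟨le_rfl, hT⟩
  have a2 : AntitoneOn (fun s => φ s - φ' 0 * s - c / 2 * s ^ 2) (Set.Icc 0 T) :=
    antitoneOn_of_deriv_nonpos (convex_Icc 0 T)
      (fun s hs => (d2 s hs).continuousAt.continuousWithinAt)
      (fun s hs => (d2 s (hsub hs)).differentiableAt.differentiableWithinAt)
      fun s hs => by
        rw [(d2 s (hsub hs)).deriv]
        have := a1 h0 (hsub hs) (hsub hs).1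
        simp only [mul_zero, sub_zero] at this
        linarith
  have := a2 h0 ⟨hT, le_rfl⟩ hT
  simp only [mul_zero, sub_zero, ne_eq, OfNat.ofNat_ne_zero, not_false_eq_true, zero_pow] at this
  linarith

theorem taylor_le_of_le_deriv2 {φ φ' φ'' : ℝ → ℝ} {c T : ℝ} (hT : 0 ≤ T)
    (h1 : ∀ s ∈ Set.Icc 0 T, HasDerivAt φ (φ' s) s)
    (h2 : ∀ s ∈ Set.Icc 0 T, HasDerivAt φ' (φ'' s) s) (hc : ∀ s ∈ Set.Icc 0 T, c ≤ φ'' s) :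
    φ 0 + T * φ' 0 + c * T ^ 2 / 2 ≤ φ T := by
  have := le_taylor_of_deriv2_le (φ := fun s => -φ s) (φ' := fun s => -φ' s)
    (φ'' := fun s => -φ'' s) (c := -c) hT (fun s hs => (h1 s hs).neg) (fun s hs => (h2 s hs).neg)
    fun s hs => neg_le_neg (hc s hs)
  linarith

/-! ### Generalized self-concordant functions -/

theorem coe_val {M ν : ℝ} {f : Vec n → EReal} (hf : IsGenSelfConcordant M ν f) {x : Vec n}
    (hx : x ∈ dom f) : ((val f x : ℝ) : EReal) = f x :=
  EReal.coe_toReal (ne_of_lt hx) (hf.ne_bot x)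

theorem mem_dom_of_le {f : Vec n → EReal} {x : Vec n} {r : ℝ} (h : f x ≤ r) : x ∈ dom f :=
  lt_of_le_of_lt h (EReal.coe_lt_top r)

theorem val_le_iff {M ν : ℝ} {f : Vec n → EReal} (hf : IsGenSelfConcordant M ν f) {x : Vec n}
    (hx : x ∈ dom f) {r : ℝ} : val f x ≤ r ↔ f x ≤ r := by
  rw [← coe_val hf hx, EReal.coe_le_coe_iff]

namespace IsGenSelfConcordant

variable {M ν : ℝ} {f : Vec n → EReal}

theorem isClosed_epigraph_comp (hf : IsGenSelfConcordant M ν f) {α : Type*} [TopologicalSpace α]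
    {p : α → Vec n} {r : α → ℝ} (hp : Continuous p) (hr : Continuous r) :
    IsClosed {s | f (p s) ≤ (r s : EReal)} :=
  hf.closed.preimage (hp.prodMk hr)

theorem le_comb (hf : IsGenSelfConcordant M ν f) {x y : Vec n} {p q : ℝ} (hx : f x ≤ p)
    (hy : f y ≤ q) {a b : ℝ} (ha : 0 ≤ a) (hb : 0 ≤ b) (hab : a + b = 1) :
    f (a • x + b • y) ≤ ((a * p + b * q : ℝ) : EReal) :=
  hf.convex (show (x, p) ∈ {p : Vec n × ℝ | f p.1 ≤ (p.2 : EReal)} from hx)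
    (show (y, q) ∈ {p : Vec n × ℝ | f p.1 ≤ (p.2 : EReal)} from hy) ha hb hab

theorem convex_dom (hf : IsGenSelfConcordant M ν f) : Convex ℝ (dom f) :=
  fun _ hx _ hy _ _ ha hb hab =>
    mem_dom_of_le (hf.le_comb (coe_val hf hx).ge (coe_val hf hy).ge ha hb hab)

theorem convexOn_val (hf : IsGenSelfConcordant M ν f) : ConvexOn ℝ (dom f) (val f) := by
  refine ⟨hf.convex_dom, fun x hx y hy a b ha hb hab => ?_⟩
  rw [val_le_iff hf (hf.convex_dom hx hy ha hb hab)]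
  exact hf.le_comb (coe_val hf hx).ge (coe_val hf hy).ge ha hb hab

theorem contDiffOn_fderiv (hf : IsGenSelfConcordant M ν f) :
    ContDiffOn ℝ 2 (fderiv ℝ (val f)) (dom f) :=
  hf.contDiff.fderiv_of_isOpen hf.isOpen_dom (by norm_num)

theorem contDiffOn_fderiv_fderiv (hf : IsGenSelfConcordant M ν f) :
    ContDiffOn ℝ 1 (fderiv ℝ (fderiv ℝ (val f))) (dom f) :=
  hf.contDiffOn_fderiv.fderiv_of_isOpen hf.isOpen_dom (by norm_num)

theorem hasDerivAt_line (x d : Vec n) (s : ℝ) : HasDerivAt (fun s : ℝ => x + s • d) d s := by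
  simpa using ((hasDerivAt_id s).smul_const d).const_add x

theorem hasDerivAt_val_line (hf : IsGenSelfConcordant M ν f) {x d : Vec n} {s : ℝ}
    (hs : x + s • d ∈ dom f) :
    HasDerivAt (fun s : ℝ => val f (x + s • d)) (slope f (x + s • d) d) s := by
  have := ((hf.contDiff.differentiableOn (by norm_num)).differentiableAt
    (hf.isOpen_dom.mem_nhds hs)).hasFDerivAt
  exact this.comp_hasDerivAt s (hasDerivAt_line x d s)

theorem hasDerivAt_slope_line (hf : IsGenSelfConcordant M ν f) {x d : Vec n} {s : ℝ}
    (hs : x + s • d ∈ dom f) :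
    HasDerivAt (fun s : ℝ => slope f (x + s • d) d) (hess f (x + s • d) d d) s := by
  have := ((hf.contDiffOn_fderiv.differentiableOn (by norm_num)).differentiableAt
    (hf.isOpen_dom.mem_nhds hs)).hasFDerivAt.comp_hasDerivAt s (hasDerivAt_line x d s)
  exact (this.clm_apply (hasDerivAt_const s d)).congr_deriv (by simp; rfl)

theorem hasDerivAt_hess_line (hf : IsGenSelfConcordant M ν f) {x d : Vec n} {s : ℝ}
    (hs : x + s • d ∈ dom f) :
    HasDerivAt (fun s : ℝ => hess f (x + s • d) d d) (third f (x + s • d) d d) s := by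
  have := ((hf.contDiffOn_fderiv_fderiv.differentiableOn (by norm_num)).differentiableAt
    (hf.isOpen_dom.mem_nhds hs)).hasFDerivAt.comp_hasDerivAt s (hasDerivAt_line x d s)
  exact ((this.clm_apply (hasDerivAt_const s d)).clm_apply (hasDerivAt_const s d)).congr_deriv
    (by simp; rfl)

theorem preimage_lineMap_eq (C : Set (Vec n)) (x d : Vec n) :
    AffineMap.lineMap x (x + d) ⁻¹' C = {s : ℝ | x + s • d ∈ C} := by
  ext s
  simp [AffineMap.lineMap_apply, add_comm]

theorem line_mem_dom (hf : IsGenSelfConcordant M ν f) {x d : Vec n} {T : ℝ} (hx : x ∈ dom f)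
    (hT : x + T • d ∈ dom f) {s : ℝ} (hs : s ∈ Set.Icc 0 T) : x + s • d ∈ dom f := by
  have hconv : Convex ℝ {s : ℝ | x + s • d ∈ dom f} := by
    rw [← preimage_lineMap_eq]
    exact hf.convex_dom.affine_preimage (AffineMap.lineMap x (x + d))
  exact hconv.ordConnected.out (by simpa using hx) hT hs

theorem isOpen_line (hf : IsGenSelfConcordant M ν f) (x d : Vec n) :
    IsOpen {s : ℝ | x + s • d ∈ dom f} :=
  hf.isOpen_dom.preimage (by fun_prop)

theorem hess_nonneg (hf : IsGenSelfConcordant M ν f) {x : Vec n} (hx : x ∈ dom f) (d : Vec n) :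
    0 ≤ hess f x d d := by
  set I := {s : ℝ | x + s • d ∈ dom f}
  have h0 : (0 : ℝ) ∈ I := by simpa [I] using hx
  have hconv : ConvexOn ℝ I (fun s => val f (x + s • d)) := by
    have := hf.convexOn_val.comp_affineMap (AffineMap.lineMap x (x + d))
    rw [preimage_lineMap_eq] at this
    refine this.congr fun s _ => ?_
    simp [AffineMap.lineMap_apply, add_comm]
  have hmono : MonotoneOn (fun s : ℝ => slope f (x + s • d) d) I := by
    refine (hconv.monotoneOn_deriv fun s hs =>
      (hf.hasDerivAt_val_line hs).differentiableAt).congr fun s hs => ?_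
    exact (hf.hasDerivAt_val_line hs).deriv
  have hd := hf.hasDerivAt_slope_line (x := x) (d := d) h0
  have := hmono.derivWithin_nonneg (x := 0)
  rw [hd.hasDerivWithinAt.derivWithin ((hf.isOpen_line x d).uniqueDiffWithinAt h0)] at this
  simpa using this

theorem le_val_of_le_hess (hf : IsGenSelfConcordant M ν f) {x d : Vec n} {T c : ℝ} (hT : 0 ≤ T)
    (hdom : ∀ s ∈ Set.Icc 0 T, x + s • d ∈ dom f)
    (hc : ∀ s ∈ Set.Icc 0 T, c ≤ hess f (x + s • d) d d) :
    val f x + T * slope f x d + c * T ^ 2 / 2 ≤ val f (x + T • d) := by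
  simpa using taylor_le_of_le_deriv2 hT (fun s hs => hf.hasDerivAt_val_line (hdom s hs))
    (fun s hs => hf.hasDerivAt_slope_line (hdom s hs)) hc

theorem val_le_of_hess_le (hf : IsGenSelfConcordant M ν f) {x d : Vec n} {T c : ℝ} (hT : 0 ≤ T)
    (hdom : ∀ s ∈ Set.Icc 0 T, x + s • d ∈ dom f)
    (hc : ∀ s ∈ Set.Icc 0 T, hess f (x + s • d) d d ≤ c) :
    val f (x + T • d) ≤ val f x + T * slope f x d + c * T ^ 2 / 2 := by
  simpa using le_taylor_of_deriv2_le hT (fun s hs => hf.hasDerivAt_val_line (hdom s hs))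
    (fun s hs => hf.hasDerivAt_slope_line (hdom s hs)) hc

theorem val_add_slope_le (hf : IsGenSelfConcordant M ν f) {x y : Vec n} (hx : x ∈ dom f)
    (hy : y ∈ dom f) : val f x + slope f x (y - x) ≤ val f y := by
  have hd : ∀ s ∈ Set.Icc (0 : ℝ) 1, x + s • (y - x) ∈ dom f := fun s hs =>
    hf.line_mem_dom hx (by simpa using hy) hs
  simpa using hf.le_val_of_le_hess zero_le_one hd fun s hs => hf.hess_nonneg (hd s hs) _

/-! ### Positive definiteness of the Hessian -/

/-- Self-concordance with `w = u` reads `|ψ'| ≤ κ ψ` for `ψ(s) = hess f (x + s • u) u u`. As `ν - 2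
≥ 0`, the factor `κ` is continuous, hence bounded on the segment, and Grönwall's inequality
propagates the zero. -/
theorem hess_line_eq_zero (hf : IsGenSelfConcordant M ν f) (hν : 2 ≤ ν) {x u : Vec n}
    (hx : x ∈ dom f) (h0 : hess f x u u = 0) {T : ℝ} (hT : x + T • u ∈ dom f) :
    ∀ s ∈ Set.Icc 0 T, hess f (x + s • u) u u = 0 := by
  have hd : ∀ s ∈ Set.Icc 0 T, x + s • u ∈ dom f := fun s hs => hf.line_mem_dom hx hT hs
  have hcont : ContinuousOn (fun s : ℝ => hess f (x + s • u) u u) (Set.Icc 0 T) := fun s hs =>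
    (hf.hasDerivAt_hess_line (hd s hs)).continuousAt.continuousWithinAt
  have hcont2 : ContinuousOn (fun s : ℝ => M * hessNorm f (x + s • u) u ^ (ν - 2) *
      ‖u‖ ^ (3 - ν)) (Set.Icc 0 T) := by
    refine (continuousOn_const.mul (ContinuousOn.rpow_const hcont.sqrt fun s _ => Or.inr ?_)).mul
      continuousOn_const
    linarith
  obtain ⟨K, hK⟩ := isCompact_Icc.bddAbove_image hcont2
  refine eq_zero_of_abs_deriv_le_mul_abs_self_of_eq_zero_right (K := K) hcont
    (fun s hs => (hf.hasDerivAt_hess_line (hd s (Set.Ico_subset_Icc_self hs))).hasDerivWithinAt)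
    (by simpa using h0) fun s hs => ?_
  have hs' := Set.Ico_subset_Icc_self hs
  have hnn := hf.hess_nonneg (hd s hs') u
  rw [Real.norm_eq_abs, Real.norm_of_nonneg hnn]
  refine (hf.bound _ (hd s hs') u u).trans ?_
  have := hK ⟨s, hs', rfl⟩
  rw [hessNorm, Real.sq_sqrt hnn, ← hessNorm]
  calc _ = (M * hessNorm f (x + s • u) u ^ (ν - 2) * ‖u‖ ^ (3 - ν)) * hess f (x + s • u) u u := by
        ring
    _ ≤ _ := by gcongr

/-- Along `u` the function lies below its tangent as long as it is finite. This condition on `s` is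
closed because the epigraph is, and it extends to the right because the domain is open, so it holds
on all of `[0, T]`. -/
theorem ray_subset_dom (hf : IsGenSelfConcordant M ν f) (hν : 2 ≤ ν) {x u : Vec n}
    (hx : x ∈ dom f) (h0 : hess f x u u = 0) {T : ℝ} (hT : 0 ≤ T) : x + T • u ∈ dom f := by
  have hsub : Set.Icc 0 T ⊆ {s : ℝ | f (x + s • u) ≤ ((val f x + s * slope f x u : ℝ) : EReal)} := by
    refine IsClosed.Icc_subset_of_forall_exists_gt ?_ ?_ ?_
    · exact (hf.isClosed_epigraph_comp (by fun_prop) (by fun_prop)).inter isClosed_Icc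
    · simp [coe_val hf hx]
    · rintro s ⟨hs, hs0, -⟩ y hy
      have hsd : x + s • u ∈ dom f := mem_dom_of_le hs
      have hnhds : {t : ℝ | x + t • u ∈ dom f} ∈ nhdsWithin s (Set.Ioi s) :=
        mem_nhdsWithin_of_mem_nhds ((hf.isOpen_line x u).mem_nhds hsd)
      obtain ⟨t, htd, ht⟩ := Filter.nonempty_of_mem
        (Filter.inter_mem hnhds (Ioc_mem_nhdsGT hy))
      have ht0 : 0 ≤ t := hs0.trans ht.1.le
      refine ⟨t, ?_, ht⟩
      rw [Set.mem_ofPred_eq, ← val_le_iff hf htd]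
      have := hf.val_le_of_hess_le ht0 (fun r hr => hf.line_mem_dom hx htd hr)
        (fun r hr => (hf.hess_line_eq_zero hν hx h0 htd r hr).le)
      linarith
  exact mem_dom_of_le (hsub ⟨hT, le_rfl⟩)

theorem hess_pos (hf : IsGenSelfConcordant M ν f) (hν : 2 ≤ ν) (hline : ContainsNoLine (dom f))
    {x u : Vec n} (hx : x ∈ dom f) (hu : u ≠ 0) : 0 < hess f x u u := by
  refine lt_of_le_of_ne (hf.hess_nonneg hx u) fun h0 => ?_
  obtain ⟨r, hr⟩ := hline x u hu
  refine hr ?_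
  rcases le_total 0 r with h | h
  · exact hf.ray_subset_dom hν hx h0.symm h
  · have := hf.ray_subset_dom hν hx (u := -u) (by simpa [hess] using h0.symm) (neg_nonneg.2 h)
    simpa using this

/-! ### The curvature constants over a compact set -/

theorem continuousOn_hess (hf : IsGenSelfConcordant M ν f) :
    ContinuousOn (fun p : Vec n × Vec n => hess f p.1 p.2 p.2) (dom f ×ˢ Set.univ) := by
  have h : ContinuousOn (fun p : Vec n × Vec n => fderiv ℝ (fderiv ℝ (val f)) p.1)
      (dom f ×ˢ Set.univ) :=
    hf.contDiffOn_fderiv_fderiv.continuousOn.comp continuousOn_fst fun p hp => hp.1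
  exact (h.clm_apply continuousOn_snd).clm_apply continuousOn_snd

/-- Homogeneity reduces the quotients to unit directions, so that they form a compact set and the
extreme curvatures are attained. -/
theorem curvatures_eq_image (f : Vec n → EReal) (C : Set (Vec n)) :
    curvatures f C = (fun p : Vec n × Vec n => hess f p.1 p.2 p.2) ''
      (C ×ˢ Metric.sphere (0 : Vec n) 1) := by
  ext r
  constructor
  · rintro ⟨u, hu, d, hd, rfl⟩
    have hd0 : ‖d‖ ≠ 0 := norm_ne_zero_iff.2 hd
    refine ⟨(u, ‖d‖⁻¹ • d), ⟨hu, by simp [norm_smul, hd0]⟩, ?_⟩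
    simp only [hess, map_smul, FunLike.coe_smul, Pi.smul_apply, smul_eq_mul]
    field_simp
  · rintro ⟨⟨u, d⟩, ⟨hu, hd⟩, rfl⟩
    have hd1 : ‖d‖ = 1 := by simpa using hd
    exact ⟨u, hu, d, fun h => by simp [h] at hd1, by simp [hd1]⟩

theorem isCompact_curvatures (hf : IsGenSelfConcordant M ν f) {C : Set (Vec n)}
    (hC : IsCompact C) (hCd : C ⊆ dom f) : IsCompact (curvatures f C) := by
  rw [curvatures_eq_image]
  exact (hC.prod (isCompact_sphere _ _)).image_of_continuousOn
    (hf.continuousOn_hess.mono (Set.prod_mono hCd (Set.subset_univ _)))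

theorem hess_le_smoothConst (hf : IsGenSelfConcordant M ν f) {C : Set (Vec n)}
    (hC : IsCompact C) (hCd : C ⊆ dom f) {u : Vec n} (hu : u ∈ C) (d : Vec n) :
    hess f u d d ≤ smoothConst f C * ‖d‖ ^ 2 := by
  by_cases hd : d = 0
  · simp [hd, hess]
  have : 0 < ‖d‖ ^ 2 := by positivity
  rw [← div_le_iff₀ this]
  exact le_csSup (hf.isCompact_curvatures hC hCd).bddAbove ⟨u, hu, d, hd, rfl⟩

theorem strongConst_le_hess (hf : IsGenSelfConcordant M ν f) {C : Set (Vec n)}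
    (hC : IsCompact C) (hCd : C ⊆ dom f) {u : Vec n} (hu : u ∈ C) (d : Vec n) :
    strongConst f C * ‖d‖ ^ 2 ≤ hess f u d d := by
  by_cases hd : d = 0
  · simp [hd, hess]
  have : 0 < ‖d‖ ^ 2 := by positivity
  rw [← le_div_iff₀ this]
  exact csInf_le (hf.isCompact_curvatures hC hCd).bddBelow ⟨u, hu, d, hd, rfl⟩

theorem strongConst_nonneg (hf : IsGenSelfConcordant M ν f) {C : Set (Vec n)}
    (hCd : C ⊆ dom f) : 0 ≤ strongConst f C := by
  refine Real.sInf_nonneg ?_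
  rintro r ⟨u, hu, d, -, rfl⟩
  exact div_nonneg (hf.hess_nonneg (hCd hu) d) (by positivity)

theorem strongConst_pos (hf : IsGenSelfConcordant M ν f) (hν : 2 ≤ ν)
    (hline : ContainsNoLine (dom f)) {C : Set (Vec n)} (hC : IsCompact C) (hCd : C ⊆ dom f)
    (hne : C.Nonempty) {d : Vec n} (hd : d ≠ 0) : 0 < strongConst f C := by
  obtain ⟨u, hu⟩ := hne
  have hmem := (hf.isCompact_curvatures hC hCd).sInf_mem ⟨_, u, hu, d, hd, rfl⟩
  obtain ⟨w, hw, e, he, h⟩ := hmem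
  rw [strongConst, h]
  have := hf.hess_pos hν hline (hCd hw) he
  positivity

theorem strongConst_le_smoothConst (hf : IsGenSelfConcordant M ν f) {C : Set (Vec n)}
    (hC : IsCompact C) (hCd : C ⊆ dom f) : strongConst f C ≤ smoothConst f C := by
  have hcomp := hf.isCompact_curvatures hC hCd
  rcases (curvatures f C).eq_empty_or_nonempty with h | h
  · simp [strongConst, smoothConst, h]
  · exact csInf_le_csSup h hcomp.bddBelow hcomp.bddAbove

end IsGenSelfConcordant

/-! ### Polytopes and level sets -/

section Polytope

variable {X : Set (Vec n)}

theorem IsPolytope.isCompact (hX : IsPolytope X) : IsCompact X := by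
  obtain ⟨s, hs, rfl⟩ := hX
  exact hs.isCompact_convexHull ℝ

theorem IsPolytope.convex (hX : IsPolytope X) : Convex ℝ X := by
  obtain ⟨s, hs, rfl⟩ := hX
  exact convex_convexHull ℝ s

theorem IsPolytope.finite_atoms (hX : IsPolytope X) (x₀ : Vec n) :
    (insert x₀ (X.extremePoints ℝ)).Finite := by
  obtain ⟨s, hs, rfl⟩ := hX
  exact (hs.subset extremePoints_convexHull_subset).insert x₀

theorem IsPolytope.convexHull_atoms (hX : IsPolytope X) {x₀ : Vec n} (hx₀ : x₀ ∈ X) :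
    convexHull ℝ (insert x₀ (X.extremePoints ℝ)) = X := by
  refine subset_antisymm (convexHull_min (Set.insert_subset hx₀ extremePoints_subset) hX.convex) ?_
  refine (closure_convexHull_extremePoints hX.isCompact hX.convex).symm.subset.trans ?_
  exact closure_minimal (convexHull_mono (Set.subset_insert _ _))
    ((hX.finite_atoms x₀).isClosed_convexHull ℝ)

theorem IsPolytope.norm_sub_le_diam (hX : IsPolytope X) {x y : Vec n} (hx : x ∈ X) (hy : y ∈ X) :
    ‖x - y‖ ≤ Metric.diam X := by
  rw [← dist_eq_norm]
  exact Metric.dist_le_diam_of_mem hX.isCompact.isBounded hx hy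

end Polytope

section LevelSet

variable {M ν : ℝ} {f : Vec n → EReal} {X : Set (Vec n)} {x₀ x : Vec n}

theorem levelSet_subset_dom : levelSet f X x₀ ⊆ dom f := fun _ hx => hx.1.2

theorem levelSet_subset : levelSet f X x₀ ⊆ X := fun _ hx => hx.1.1

theorem mem_levelSet_iff (hf : IsGenSelfConcordant M ν f) (hx₀ : x₀ ∈ dom f) :
    x ∈ levelSet f X x₀ ↔ x ∈ X ∧ f x ≤ (val f x₀ : EReal) := by
  rw [coe_val hf hx₀]
  exact ⟨fun h => ⟨h.1.1, h.2⟩, fun h => ⟨⟨h.1, lt_of_le_of_lt h.2 hx₀⟩, h.2⟩⟩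

theorem mem_levelSet_of_val_le (hf : IsGenSelfConcordant M ν f) (hx₀ : x₀ ∈ dom f) (hxX : x ∈ X)
    (hx : x ∈ dom f) (h : val f x ≤ val f x₀) : x ∈ levelSet f X x₀ :=
  (mem_levelSet_iff hf hx₀).2 ⟨hxX, (val_le_iff hf hx).1 h⟩

theorem val_le_of_mem_levelSet (hf : IsGenSelfConcordant M ν f) (hx₀ : x₀ ∈ dom f)
    (hx : x ∈ levelSet f X x₀) : val f x ≤ val f x₀ :=
  (val_le_iff hf hx.1.2).2 ((mem_levelSet_iff hf hx₀).1 hx).2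

theorem isCompact_levelSet (hf : IsGenSelfConcordant M ν f) (hX : IsPolytope X)
    (hx₀ : x₀ ∈ dom f) : IsCompact (levelSet f X x₀) := by
  have : levelSet f X x₀ = X ∩ {x | f x ≤ (val f x₀ : EReal)} := by
    ext x; exact mem_levelSet_iff hf hx₀
  rw [this]
  exact hX.isCompact.inter_right (hf.isClosed_epigraph_comp continuous_id continuous_const)

theorem convex_levelSet (hf : IsGenSelfConcordant M ν f) (hX : IsPolytope X)
    (hx₀ : x₀ ∈ dom f) : Convex ℝ (levelSet f X x₀) := by
  intro x hx y hy a b ha hb hab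
  rw [mem_levelSet_iff hf hx₀] at hx hy ⊢
  refine ⟨hX.convex hx.1 hy.1 ha hb hab, (hf.le_comb hx.2 hy.2 ha hb hab).trans ?_⟩
  rw [← add_mul, hab, one_mul]

theorem Convex.line_mem {C : Set (Vec n)} (hC : Convex ℝ C) {x d : Vec n} {T : ℝ} (hx : x ∈ C)
    (hT : x + T • d ∈ C) {s : ℝ} (hs : s ∈ Set.Icc 0 T) : x + s • d ∈ C := by
  have hconv : Convex ℝ {s : ℝ | x + s • d ∈ C} := by
    rw [← IsGenSelfConcordant.preimage_lineMap_eq]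
    exact hC.affine_preimage (AffineMap.lineMap x (x + d))
  exact hconv.ordConnected.out (by simpa using hx) hT hs

/-- A minimizer of `f` over `X` in the initial level set. -/
theorem exists_minimizer (hf : IsGenSelfConcordant M ν f) (hX : IsPolytope X)
    (hx₀ : x₀ ∈ X ∩ dom f) :
    ∃ z ∈ levelSet f X x₀, (∀ y ∈ X ∩ dom f, val f z ≤ val f y) ∧
      ∀ y, primalGap f X y = val f y - val f z := by
  have hx₀L : x₀ ∈ levelSet f X x₀ := ⟨hx₀, le_rfl⟩
  obtain ⟨z, hz, hmin⟩ := (isCompact_levelSet hf hX hx₀.2).exists_isMinOn ⟨x₀, hx₀L⟩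
    (hf.contDiff.continuousOn.mono levelSet_subset_dom)
  have hle : ∀ y ∈ X ∩ dom f, val f z ≤ val f y := fun y hy => by
    rcases le_or_gt (val f y) (val f x₀) with h | h
    · exact hmin (mem_levelSet_of_val_le hf hx₀.2 hy.1 hy.2 h)
    · exact (hmin hx₀L).trans h.le
  refine ⟨z, hz, hle, fun y => ?_⟩
  have : IsLeast (val f '' (X ∩ dom f)) (val f z) :=
    ⟨⟨z, hz.1, rfl⟩, by rintro _ ⟨y, hy, rfl⟩; exact hle y hy⟩
  rw [primalGap, this.csInf_eq]

theorem primalGap_nonneg (hf : IsGenSelfConcordant M ν f) (hX : IsPolytope X)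
    (hx₀ : x₀ ∈ X ∩ dom f) (hx : x ∈ X ∩ dom f) : 0 ≤ primalGap f X x := by
  obtain ⟨z, -, hle, hgap⟩ := exists_minimizer hf hX hx₀
  rw [hgap]
  exact sub_nonneg.2 (hle x hx)

end LevelSet

/-! ### The line search -/

section LineSearch

theorem slope_sub (f : Vec n → EReal) (x u v : Vec n) :
    slope f x (u - v) = slope f x u - slope f x v :=
  map_sub _ _ _

theorem slope_zero (f : Vec n → EReal) (x : Vec n) : slope f x 0 = 0 :=
  map_zero _

variable {M ν : ℝ} {f : Vec n → EReal} {X : Set (Vec n)} {x₀ x d : Vec n} {γmax L : ℝ}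

theorem stepSize_nonneg (hγ : 0 ≤ γmax) (hL : 0 < L) (hd : slope f x d ≤ 0) :
    0 ≤ stepSize f x d γmax L :=
  le_min (div_nonneg (neg_nonneg.2 hd) (by positivity)) hγ

theorem stepSize_mul_le (hL : 0 < L) (hd : slope f x d ≤ 0) :
    stepSize f x d γmax L * (L * ‖d‖ ^ 2) ≤ -slope f x d := by
  rcases eq_or_ne d 0 with rfl | h
  · simpa using hd
  · rw [← le_div_iff₀ (by positivity)]
    exact min_le_left _ _

/-- `L_f` controls the Hessian only on the level set, so it must be shown that the segment up to `γ`
does not leave it. This is a continuous induction on `[0, γ]`: as `γ L ‖d‖² ≤ q`, the quadratic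
bound gives `f(x + t d) ≤ f(x) - t q / 2` as far as the segment is known to stay inside. -/
theorem accepts_of_smoothConst_le (hf : IsGenSelfConcordant M ν f) (hX : IsPolytope X)
    (hx₀ : x₀ ∈ dom f) (hx : x ∈ levelSet f X x₀) (hγ : 0 ≤ γmax) (hxd : x + γmax • d ∈ X)
    (hd : slope f x d ≤ 0) (hL : 0 < L) (hsmooth : smoothConst f (levelSet f X x₀) ≤ L) :
    Accepts f x d γmax L := by
  have hγ0 := stepSize_nonneg hγ hL hd
  have hstep := stepSize_mul_le (γmax := γmax) hL hd
  have hγle : stepSize f x d γmax L ≤ γmax := min_le_right _ _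
  rw [Accepts]
  set γ := stepSize f x d γmax L with hγdef
  rcases hd.eq_or_lt with h0 | hneg
  · have : γ = 0 := by rw [hγdef, stepSize, h0]; simp [hγ]
    simp [this, hx.1.2]
  have hcomp := isCompact_levelSet hf hX hx₀
  have hconv := convex_levelSet hf hX hx₀
  have hquad : ∀ t : ℝ, 0 ≤ t → x + t • d ∈ levelSet f X x₀ →
      val f (x + t • d) ≤ val f x + t * slope f x d + L * ‖d‖ ^ 2 * t ^ 2 / 2 := by
    intro t ht htl
    have hl : ∀ s ∈ Set.Icc 0 t, x + s • d ∈ levelSet f X x₀ := fun s hs =>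
      Convex.line_mem hconv hx htl hs
    refine hf.val_le_of_hess_le ht (fun s hs => levelSet_subset_dom (hl s hs)) fun s hs => ?_
    refine (hf.hess_le_smoothConst hcomp levelSet_subset_dom (hl s hs) d).trans ?_
    gcongr
  have hmemX : ∀ t ∈ Set.Icc 0 γ, x + t • d ∈ X := fun t ht =>
    Convex.line_mem hX.convex (levelSet_subset hx) hxd ⟨ht.1, ht.2.trans hγle⟩
  have hsub : Set.Icc 0 γ ⊆ {t : ℝ | f (x + t • d) ≤ (val f x₀ : EReal)} := by
    refine IsClosed.Icc_subset_of_forall_exists_gt ?_ ?_ ?_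
    · exact (hf.isClosed_epigraph_comp (by fun_prop) continuous_const).inter isClosed_Icc
    · simpa using ((mem_levelSet_iff hf hx₀).1 hx).2
    · rintro t ⟨ht, ht0, htγ⟩ y hy
      have htd : x + t • d ∈ dom f := mem_dom_of_le ht
      have hev : ∀ᶠ s in nhdsWithin t (Set.Ioi t), x + s • d ∈ dom f :=
        mem_nhdsWithin_of_mem_nhds ((hf.isOpen_line x d).mem_nhds htd)
      have hval : ∀ᶠ s in nhdsWithin t (Set.Ioi t), val f (x + s • d) ≤ val f x₀ := by
        have hderiv := hf.hasDerivAt_val_line htd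
        -- At `t = 0` the value may equal `f(x₀)` and the negative derivative is needed; for `t > 0`
        -- the quadratic bound is strict and continuity suffices.
        rcases ht0.eq_or_lt with rfl | htpos
        · have hslope : ∀ᶠ s in nhdsWithin (0 : ℝ) (Set.Ioi 0),
              _root_.slope (fun s : ℝ => val f (x + s • d)) 0 s < 0 := by
            have := (hasDerivAt_iff_tendsto_slope.1 hderiv).mono_left
              (nhdsWithin_mono 0 fun s (hs : 0 < s) => hs.ne')
            exact this.eventually_lt_const (by simpa using hneg)
          filter_upwards [hslope, self_mem_nhdsWithin] with s hs (hs0 : 0 < s)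
          rw [slope_def_field, sub_zero, div_neg_iff] at hs
          have hlt := hs.resolve_left fun h => by linarith [h.2]
          have := val_le_of_mem_levelSet hf hx₀ hx
          simp only [zero_smul, add_zero] at hlt
          linarith [hlt.1]
        · refine (hderiv.continuousAt.eventually_lt_const
            (?_ : val f (x + t • d) < val f x₀)).filter_mono nhdsWithin_le_nhds |>.mono
            fun s hs => hs.le
          have h1 := hquad t ht0 ((mem_levelSet_iff hf hx₀).2 ⟨hmemX t ⟨ht0, htγ.le⟩, ht⟩)
          have h2 := val_le_of_mem_levelSet hf hx₀ hx
          have h3 : t * (L * ‖d‖ ^ 2) ≤ -slope f x d :=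
            (mul_le_mul_of_nonneg_right htγ.le (by positivity)).trans hstep
          have h4 := mul_le_mul_of_nonneg_left h3 htpos.le
          have h5 := mul_pos htpos (neg_pos.2 hneg)
          nlinarith
      obtain ⟨s, ⟨hsd, hsv⟩, hs⟩ := Filter.nonempty_of_mem
        (Filter.inter_mem (hev.and hval) (Ioc_mem_nhdsGT hy))
      exact ⟨s, (val_le_iff hf hsd).1 hsv, hs⟩
  have hγmem : x + γ • d ∈ levelSet f X x₀ :=
    (mem_levelSet_iff hf hx₀).2 ⟨hmemX γ ⟨hγ0, le_rfl⟩, hsub ⟨hγ0, le_rfl⟩⟩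
  refine ⟨levelSet_subset_dom hγmem, ?_⟩
  linarith [hquad γ hγ0 hγmem]

theorem Accepts.half_mul_le (h : Accepts f x d γmax L) (hγ : 0 ≤ γmax) (hL : 0 < L)
    (hd : slope f x d ≤ 0) :
    stepSize f x d γmax L * -slope f x d / 2 ≤
      val f x - val f (x + stepSize f x d γmax L • d) := by
  have h1 := mul_le_mul_of_nonneg_left (stepSize_mul_le (γmax := γmax) hL hd)
    (stepSize_nonneg hγ hL hd)
  have h2 := h.2
  nlinarith

theorem IsInitialEstimate.pos {Lprev m : ℝ} (h : IsInitialEstimate Lprev m) (hL : 0 < Lprev) :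
    0 < m := by
  obtain ⟨η, h0, -, h1, -⟩ := h
  exact (mul_pos h0 hL).trans_le h1

theorem exists_accepts (hf : IsGenSelfConcordant M ν f) (hX : IsPolytope X)
    (hx₀ : x₀ ∈ dom f) (hx : x ∈ levelSet f X x₀) (hγ : 0 ≤ γmax) (hxd : x + γmax • d ∈ X)
    (hd : slope f x d ≤ 0) {τ m : ℝ} (hτ : 1 < τ) (hm : 0 < m) :
    ∃ k : ℕ, Accepts f x d γmax (τ ^ k * m) := by
  obtain ⟨k, hk⟩ := pow_unbounded_of_one_lt (smoothConst f (levelSet f X x₀) / m) hτ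
  refine ⟨k, accepts_of_smoothConst_le hf hX hx₀ hx hγ hxd hd (by positivity) ?_⟩
  exact ((div_lt_iff₀ hm).1 hk).le

/-- If the estimate was ever increased, the preceding one was rejected and thus smaller than `L_f`,
so the final one is at most `τ L_f`. -/
theorem IsBacktrack.spec (hf : IsGenSelfConcordant M ν f) (hX : IsPolytope X)
    (hx₀ : x₀ ∈ dom f) (hx : x ∈ levelSet f X x₀) (hγ : 0 ≤ γmax) (hxd : x + γmax • d ∈ X)
    (hd : slope f x d ≤ 0) {τ Lprev γ Linit : ℝ} (hτ : 1 < τ) (hLprev : 0 < Lprev)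
    (hle : Lprev ≤ Ltilde f X x₀ Linit τ) (h : IsBacktrack f x d τ Lprev γmax γ L) :
    0 < L ∧ L ≤ Ltilde f X x₀ Linit τ ∧ Accepts f x d γmax L ∧ γ = stepSize f x d γmax L := by
  obtain ⟨m, hm, k, hrej, hacc, rfl, rfl⟩ := h
  have hm0 := hm.pos hLprev
  refine ⟨by positivity, ?_, hacc, rfl⟩
  cases k with
  | zero =>
    obtain ⟨η, -, -, -, hm1⟩ := hm
    simpa using hm1.trans hle
  | succ j =>
    have hlt : τ ^ j * m < smoothConst f (levelSet f X x₀) := by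
      by_contra! hge
      exact hrej j (Nat.lt_succ_self j)
        (accepts_of_smoothConst_le hf hX hx₀ hx hγ hxd hd (by positivity) hge)
    calc τ ^ (j + 1) * m = τ * (τ ^ j * m) := by ring
      _ ≤ τ * smoothConst f (levelSet f X x₀) := by gcongr
      _ ≤ _ := le_max_left _ _

end LineSearch

/-! ### Active sets and directions -/

section Weights

variable {c : Vec n →₀ ℝ} {x v a : Vec n} {γ : ℝ}

theorem IsProperConvexComb.nonneg (hc : IsProperConvexComb c x) (y : Vec n) : 0 ≤ c y := by
  by_cases h : y ∈ c.support
  · exact (hc.1 y h).le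
  · exact (Finsupp.notMem_support_iff.1 h).ge

theorem isProperConvexComb_of_nonneg (h0 : ∀ y, 0 ≤ c y) (h1 : (c.sum fun _ r => r) = 1)
    (h2 : (c.sum fun y r => r • y) = x) : IsProperConvexComb c x :=
  ⟨fun y hy => lt_of_le_of_ne (h0 y) (Finsupp.mem_support_iff.1 hy).symm, h1, h2⟩

theorem IsProperConvexComb.mem_convexHull (hc : IsProperConvexComb c x) :
    x ∈ convexHull ℝ (c.support : Set (Vec n)) := by
  rw [← hc.2.2]
  exact (convex_convexHull ℝ _).sum_mem (fun y _ => hc.nonneg y) hc.2.1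
    fun y hy => subset_convexHull ℝ _ hy

theorem IsProperConvexComb.mem_of_convex (hc : IsProperConvexComb c x) {C : Set (Vec n)}
    (hC : Convex ℝ C) (h : (c.support : Set (Vec n)) ⊆ C) : x ∈ C :=
  convexHull_min h hC hc.mem_convexHull

theorem IsProperConvexComb.slope_le (hc : IsProperConvexComb c x) (f : Vec n → EReal) {z : Vec n}
    {m : ℝ} (h : ∀ y ∈ c.support, slope f z y ≤ m) : slope f z x ≤ m :=
  hc.mem_of_convex (C := {y | slope f z y ≤ m})
    (convex_halfSpace_le (fderiv ℝ (val f) z).toLinearMap.isLinear m) h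

theorem IsProperConvexComb.support_nonempty (hc : IsProperConvexComb c x) :
    c.support.Nonempty := by
  rw [Finsupp.support_nonempty_iff]
  rintro rfl
  simpa using hc.2.1

theorem sum_linear (c e : Vec n →₀ ℝ) (a b : ℝ) {F : Type*} [AddCommGroup F] [Module ℝ F]
    (φ : Vec n → F) : ((a • c + b • e).sum fun y r => r • φ y) =
      a • (c.sum fun y r => r • φ y) + b • (e.sum fun y r => r • φ y) := by
  simpa [Finsupp.linearCombination_apply] using
    (Finsupp.linearCombination ℝ φ).map_add (a • c) (b • e)

/-- Common form of both updates: an away step is a step towards `a` of length `-γ`. -/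
theorem IsProperConvexComb.affine_update (hc : IsProperConvexComb c x) {γ : ℝ} (y : Vec n)
    (h0 : ∀ z, 0 ≤ ((1 - γ) • c + γ • Finsupp.single y (1 : ℝ)) z) :
    IsProperConvexComb ((1 - γ) • c + γ • Finsupp.single y (1 : ℝ)) (x + γ • (y - x)) := by
  refine isProperConvexComb_of_nonneg h0 ?_ ?_
  · have := sum_linear c (Finsupp.single y (1 : ℝ)) (1 - γ) γ (fun _ => (1 : ℝ))
    simp only [smul_eq_mul, mul_one, hc.2.1] at this
    rw [this]; simp
  · rw [sum_linear c (Finsupp.single y (1 : ℝ)) (1 - γ) γ (fun y => y), hc.2.2]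
    simp only [zero_smul, Finsupp.sum_single_index, one_smul]
    module

theorem IsProperConvexComb.fw_update (hc : IsProperConvexComb c x) (hγ0 : 0 ≤ γ) (hγ1 : γ ≤ 1) :
    IsProperConvexComb ((1 - γ) • c + Finsupp.single v γ) (x + γ • (v - x)) := by
  have he : Finsupp.single v γ = γ • Finsupp.single v (1 : ℝ) := by simp
  rw [he]
  refine hc.affine_update v fun z => ?_
  have h1 := mul_nonneg (sub_nonneg.2 hγ1) (hc.nonneg z)
  have h2 : 0 ≤ Finsupp.single v (1 : ℝ) z := by
    rw [Finsupp.single_apply]; split_ifs <;> norm_num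
  simpa only [Finsupp.add_apply, Finsupp.smul_apply, smul_eq_mul] using
    add_nonneg h1 (mul_nonneg hγ0 h2)

theorem IsProperConvexComb.away_update (hc : IsProperConvexComb c x) (hγ0 : 0 ≤ γ)
    (hγ : γ * (1 - c a) ≤ c a) :
    IsProperConvexComb ((1 + γ) • c - Finsupp.single a γ) (x + γ • (x - a)) := by
  have he : (1 + γ) • c - Finsupp.single a γ =
      (1 - -γ) • c + (-γ) • Finsupp.single a (1 : ℝ) := by
    simp [sub_eq_add_neg]
  have hx : x + γ • (x - a) = x + (-γ) • (a - x) := by module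
  rw [he, hx]
  refine hc.affine_update a fun z => ?_
  have h1 := mul_nonneg (add_nonneg zero_le_one hγ0) (hc.nonneg z)
  by_cases hz : z = a
  · subst hz
    simp
    linarith
  · simpa [Finsupp.single_apply, Ne.symm hz] using h1

/-- A weight of one leaves nothing for the other atoms and forces `x = a`. It makes the denominator
`1 - c a` of the maximal away step positive. -/
theorem IsProperConvexComb.weight_lt_one (hc : IsProperConvexComb c x) (ha : a ∈ c.support)
    (hax : a ≠ x) : c a < 1 := by
  by_contra! hge
  have hsum : c a + ∑ y ∈ c.support.erase a, c y = 1 := by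
    rw [Finset.add_sum_erase _ _ ha]; exact hc.2.1
  have hzero : ∑ y ∈ c.support.erase a, c y = 0 :=
    le_antisymm (by linarith) (Finset.sum_nonneg fun y _ => hc.nonneg y)
  have hempty := (Finset.sum_eq_zero_iff_of_nonneg fun y _ => hc.nonneg y).1 hzero
  refine hax ?_
  rw [← hc.2.2, Finsupp.sum, ← Finset.add_sum_erase _ _ ha,
    Finset.sum_eq_zero fun y hy => by rw [hempty y hy, zero_smul]]
  have : c a = 1 := by linarith
  simp [this]

end Weights

/-! ### One iteration -/

/-- The invariant of the iterates: `x` lies in the initial level set and is the proper convex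
combination, with weights `c`, of vertices of `X` and `x₀`. -/
structure IsIterate (f : Vec n → EReal) (X : Set (Vec n)) (x₀ x : Vec n) (c : Vec n →₀ ℝ) :
    Prop where
  comb : IsProperConvexComb c x
  subset_atoms : (c.support : Set (Vec n)) ⊆ insert x₀ (X.extremePoints ℝ)
  mem_levelSet : x ∈ levelSet f X x₀

section Iteration

variable {M ν : ℝ} {f : Vec n → EReal} {X : Set (Vec n)} {x₀ x v a d : Vec n} {c : Vec n →₀ ℝ}
  {γmax L : ℝ}

theorem atoms_subset (hx₀ : x₀ ∈ X) : insert x₀ (X.extremePoints ℝ) ⊆ X :=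
  Set.insert_subset hx₀ extremePoints_subset

namespace IsDirection

theorem slope_le_a (hdir : IsDirection f X x c v a d γmax) (hit : IsIterate f X x₀ x c) :
    slope f x x ≤ slope f x a := hit.comb.slope_le f hdir.argmax

theorem slope_v_le_x (hdir : IsDirection f X x c v a d γmax) (hit : IsIterate f X x₀ x c) :
    slope f x v ≤ slope f x x := hdir.argmin x (levelSet_subset hit.mem_levelSet)

/-- The two candidate slopes add up to `⟨∇f(x), a - v⟩`, and the algorithm takes the larger. -/
theorem half_le (hdir : IsDirection f X x c v a d γmax) :
    slope f x (a - v) ≤ 2 * -slope f x d := by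
  rcases le_or_gt (slope f x (a - x)) (slope f x (x - v)) with h | h
  · rw [(hdir.fwStep h).1]
    simp only [slope_sub] at *
    linarith
  · rw [(hdir.awayStep h).1]
    simp only [slope_sub] at *
    linarith

theorem slope_nonpos (hdir : IsDirection f X x c v a d γmax) (hit : IsIterate f X x₀ x c) :
    slope f x d ≤ 0 := by
  have h1 := hdir.half_le
  have h2 := hdir.slope_le_a hit
  have h3 := hdir.slope_v_le_x hit
  rw [slope_sub] at h1
  linarith

theorem norm_le (hdir : IsDirection f X x c v a d γmax) (hX : IsPolytope X) (hx₀ : x₀ ∈ X)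
    (hit : IsIterate f X x₀ x c) : ‖d‖ ≤ Metric.diam X := by
  have hx := levelSet_subset hit.mem_levelSet
  rcases le_or_gt (slope f x (a - x)) (slope f x (x - v)) with h | h
  · rw [(hdir.fwStep h).1]
    exact hX.norm_sub_le_diam (extremePoints_subset hdir.vertex) hx
  · rw [(hdir.awayStep h).1]
    exact hX.norm_sub_le_diam hx (atoms_subset hx₀ (hit.subset_atoms hdir.active))

theorem weight_lt_one (hdir : IsDirection f X x c v a d γmax) (hit : IsIterate f X x₀ x c)
    (h : slope f x (x - v) < slope f x (a - x)) : c a < 1 := by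
  refine hit.comb.weight_lt_one hdir.active fun hax => ?_
  have := hdir.slope_v_le_x hit
  rw [hax, sub_self, slope_zero, slope_sub] at h
  linarith

theorem γmax_nonneg (hdir : IsDirection f X x c v a d γmax) (hit : IsIterate f X x₀ x c) :
    0 ≤ γmax := by
  rcases le_or_gt (slope f x (a - x)) (slope f x (x - v)) with h | h
  · rw [(hdir.fwStep h).2]; exact zero_le_one
  · rw [(hdir.awayStep h).2]
    exact div_nonneg (hit.comb.nonneg a) (sub_nonneg.2 (hdir.weight_lt_one hit h).le)

theorem fw_comb (hdir : IsDirection f X x c v a d γmax) (hit : IsIterate f X x₀ x c) {γ : ℝ}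
    (hγ0 : 0 ≤ γ) (hγ : γ ≤ γmax) (h : slope f x (a - x) ≤ slope f x (x - v)) :
    IsProperConvexComb ((1 - γ) • c + Finsupp.single v γ) (x + γ • d) := by
  obtain ⟨rfl, rfl⟩ := hdir.fwStep h
  exact hit.comb.fw_update hγ0 hγ

theorem away_comb (hdir : IsDirection f X x c v a d γmax) (hit : IsIterate f X x₀ x c) {γ : ℝ}
    (hγ0 : 0 ≤ γ) (hγ : γ ≤ γmax) (h : slope f x (x - v) < slope f x (a - x)) :
    IsProperConvexComb ((1 + γ) • c - Finsupp.single a γ) (x + γ • d) := by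
  obtain ⟨rfl, rfl⟩ := hdir.awayStep h
  rw [le_div_iff₀ (sub_pos.2 (hdir.weight_lt_one hit h))] at hγ
  exact hit.comb.away_update hγ0 hγ

theorem fw_support_subset {γ : ℝ} :
    ((1 - γ) • c + Finsupp.single v γ).support ⊆ insert v c.support := by
  classical
  refine Finsupp.support_add.trans (Finset.union_subset ?_ ?_)
  · exact Finsupp.support_smul.trans (Finset.subset_insert _ _)
  · exact Finsupp.support_single_subset.trans (by simp)

theorem away_support_subset (ha : a ∈ c.support) {γ : ℝ} :
    ((1 + γ) • c - Finsupp.single a γ).support ⊆ c.support := by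
  classical
  refine Finsupp.support_sub.trans (Finset.union_subset Finsupp.support_smul ?_)
  exact Finsupp.support_single_subset.trans (by simpa using ha)

theorem add_smul_mem (hdir : IsDirection f X x c v a d γmax) (hX : IsPolytope X) (hx₀ : x₀ ∈ X)
    (hit : IsIterate f X x₀ x c) : x + γmax • d ∈ X := by
  rcases le_or_gt (slope f x (a - x)) (slope f x (x - v)) with h | h
  · refine (hdir.fw_comb hit (hdir.γmax_nonneg hit) le_rfl h).mem_of_convex hX.convex ?_
    refine (Finset.coe_subset.2 fw_support_subset).trans ?_
    rw [Finset.coe_insert]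
    exact Set.insert_subset (extremePoints_subset hdir.vertex)
      (hit.subset_atoms.trans (atoms_subset hx₀))
  · refine (hdir.away_comb hit (hdir.γmax_nonneg hit) le_rfl h).mem_of_convex hX.convex ?_
    exact (Finset.coe_subset.2 (away_support_subset hdir.active)).trans
      (hit.subset_atoms.trans (atoms_subset hx₀))

theorem slope_sub_le (hdir : IsDirection f X x c v a d γmax) {u y : Vec n} (hu : u ∈ c.support)
    (hy : y ∈ X) : slope f x (u - y) ≤ slope f x (a - v) := by
  rw [slope_sub, slope_sub]
  linarith [hdir.argmax u hu, hdir.argmin y hy]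

theorem fwGap_eq (hdir : IsDirection f X x c v a d γmax) : fwGap f X x = slope f x (x - v) := by
  refine IsGreatest.csSup_eq ⟨⟨v, extremePoints_subset hdir.vertex, rfl⟩, ?_⟩
  rintro _ ⟨y, hy, rfl⟩
  simp only [slope_sub]
  linarith [hdir.argmin y hy]

theorem strongGap_eq (hdir : IsDirection f X x c v a d γmax) :
    strongGap f X x c.support = slope f x (a - v) := by
  refine IsGreatest.csSup_eq
    ⟨⟨(a, v), ⟨hdir.active, extremePoints_subset hdir.vertex⟩, rfl⟩, ?_⟩
  rintro _ ⟨⟨u, y⟩, ⟨hu, hy⟩, rfl⟩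
  exact hdir.slope_sub_le hu hy

theorem fwGap_le_strongGap (hdir : IsDirection f X x c v a d γmax) (hit : IsIterate f X x₀ x c) :
    fwGap f X x ≤ strongGap f X x c.support := by
  rw [hdir.fwGap_eq, hdir.strongGap_eq, slope_sub, slope_sub]
  linarith [hdir.slope_le_a hit]

theorem strongGap_nonneg (hdir : IsDirection f X x c v a d γmax) (hit : IsIterate f X x₀ x c) :
    0 ≤ strongGap f X x c.support := by
  rw [hdir.strongGap_eq, slope_sub]
  linarith [hdir.slope_le_a hit, hdir.slope_v_le_x hit]

theorem primalGap_le_fwGap (hdir : IsDirection f X x c v a d γmax)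
    (hf : IsGenSelfConcordant M ν f) (hX : IsPolytope X) (hx₀ : x₀ ∈ X ∩ dom f)
    (hit : IsIterate f X x₀ x c) : primalGap f X x ≤ fwGap f X x := by
  obtain ⟨z, hz, -, hgap⟩ := exists_minimizer hf hX hx₀
  have h1 := hf.val_add_slope_le hit.mem_levelSet.1.2 hz.1.2
  have h2 := hdir.argmin z hz.1.1
  rw [hgap, hdir.fwGap_eq, slope_sub]
  rw [slope_sub] at h1
  linarith

/-- Geometric strong convexity. -/
theorem primalGap_le_sq (hdir : IsDirection f X x c v a d γmax)
    (hf : IsGenSelfConcordant M ν f) (hX : IsPolytope X) (hx₀ : x₀ ∈ X ∩ dom f)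
    (hit : IsIterate f X x₀ x c) :
    2 * strongConst f (levelSet f X x₀) * atomWidth X x₀ ^ 2 * primalGap f X x ≤
      strongGap f X x c.support ^ 2 := by
  obtain ⟨z, hz, -, hgap⟩ := exists_minimizer hf hX hx₀
  have hcomp := isCompact_levelSet hf hX hx₀.2
  have hxz : ∀ s ∈ Set.Icc (0 : ℝ) 1, x + s • (z - x) ∈ levelSet f X x₀ := fun s hs =>
    Convex.line_mem (convex_levelSet hf hX hx₀.2) hit.mem_levelSet (by simpa using hz) hs
  have hstrong := hf.le_val_of_le_hess zero_le_one
    (fun s hs => levelSet_subset_dom (hxz s hs))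
    (fun s hs => hf.strongConst_le_hess hcomp levelSet_subset_dom (hxz s hs) (z - x))
  have hμ : 0 ≤ strongConst f (levelSet f X x₀) := hf.strongConst_nonneg levelSet_subset_dom
  have hδ : 0 ≤ atomWidth X x₀ := pyramidalWidth_nonneg (hX.finite_atoms x₀)
  have hw := hdir.strongGap_nonneg hit
  -- The width inequality is applied to the negative gradient `ρ = -∇f(x)` and the minimizer `z`.
  set ρ := (InnerProductSpace.toDual ℝ (Vec n)).symm (-fderiv ℝ (val f) x)
  have hρ : ∀ y, inner ℝ ρ y = -slope f x y := fun y => by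
    rw [InnerProductSpace.toDual_symm_apply]; rfl
  have hwidth := pyramidalWidth_mul_inner_le (hX.finite_atoms x₀) (ρ := ρ) (y := z) hit.comb
    hit.subset_atoms (by rw [hX.convexHull_atoms hx₀.1]; exact hz.1.1) hw fun s hs u hu => by
      rw [hρ, hdir.strongGap_eq]
      refine le_trans (le_of_eq ?_) (hdir.slope_sub_le hu (atoms_subset hx₀.1 hs))
      rw [slope_sub, slope_sub]; ring
  rw [← atomWidth, hρ] at hwidth
  rw [hgap]
  simp only [one_mul, one_smul, add_sub_cancel, one_pow, mul_one] at hstrong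
  set μ := strongConst f (levelSet f X x₀)
  set δ := atomWidth X x₀
  set w := strongGap f X x c.support
  set e := ‖z - x‖
  have h1 : val f x - val f z ≤ -slope f x (z - x) - μ * e ^ 2 / 2 := by linarith
  calc 2 * μ * δ ^ 2 * (val f x - val f z)
      ≤ 2 * μ * δ ^ 2 * (-slope f x (z - x) - μ * e ^ 2 / 2) := by gcongr
    _ = 2 * μ * δ * (δ * -slope f x (z - x)) - (μ * δ * e) ^ 2 := by ring
    _ ≤ 2 * μ * δ * (w * e) - (μ * δ * e) ^ 2 := by gcongr
    _ ≤ w ^ 2 := by nlinarith [sq_nonneg (w - μ * δ * e)]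

theorem decrease_nonneg (hdir : IsDirection f X x c v a d γmax) (hit : IsIterate f X x₀ x c)
    (hL : 0 < L) (hacc : Accepts f x d γmax L) :
    0 ≤ val f x - val f (x + stepSize f x d γmax L • d) := by
  have hd := hdir.slope_nonpos hit
  have hγ := hdir.γmax_nonneg hit
  refine le_trans ?_ (hacc.half_mul_le hγ hL hd)
  have := mul_nonneg (stepSize_nonneg hγ hL hd) (neg_nonneg.2 hd)
  linarith

/-- The decrease achieved by a step that is not an away step of maximal length. -/
theorem decrease (hdir : IsDirection f X x c v a d γmax) (hf : IsGenSelfConcordant M ν f)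
    (hX : IsPolytope X) (hx₀ : x₀ ∈ X ∩ dom f) (hit : IsIterate f X x₀ x c) (hL : 0 < L)
    (hacc : Accepts f x d γmax L)
    (hdrop : ¬ (slope f x (x - v) < slope f x (a - x) ∧ stepSize f x d γmax L = γmax)) :
    strongGap f X x c.support ^ 2 ≤ 8 * L * Metric.diam X ^ 2 *
        (val f x - val f (x + stepSize f x d γmax L • d)) ∨
      (strongGap f X x c.support ≤ 4 * (val f x - val f (x + stepSize f x d γmax L • d)) ∧
        primalGap f X x ≤ 2 * (val f x - val f (x + stepSize f x d γmax L • d))) := by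
  have hd := hdir.slope_nonpos hit
  have hγ := hdir.γmax_nonneg hit
  have hhalf := hdir.half_le
  rw [← hdir.strongGap_eq] at hhalf
  have hw := hdir.strongGap_nonneg hit
  have hdec := hacc.half_mul_le hγ hL hd
  have hdec0 := hdir.decrease_nonneg hit hL hacc
  have hnorm := hdir.norm_le hX hx₀.1 hit
  set γ := stepSize f x d γmax L with hγdef
  set Δ := val f x - val f (x + γ • d)
  set q := -slope f x d with hq
  set w := strongGap f X x c.support
  have hq0 : 0 ≤ q := neg_nonneg.2 hd
  -- A truncated step is here a full Frank-Wolfe step with `γ = 1`, since drop steps are excluded.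
  -- The case `d = 0` joins the other branch, where `q = 0`.
  by_cases hlt : γ = γmax ∧ d ≠ 0
  · right
    have hfw : slope f x (a - x) ≤ slope f x (x - v) := by
      by_contra! h
      exact hdrop ⟨h, hlt.1⟩
    obtain ⟨hdv, hγ1⟩ := hdir.fwStep hfw
    rw [hlt.1, hγ1] at hdec
    have hgap := hdir.primalGap_le_fwGap hf hX hx₀ hit
    have hqg : fwGap f X x = q := by
      rw [hdir.fwGap_eq, hq, hdv, slope_sub, slope_sub]; ring
    constructor <;> linarith
  · left
    have hγq : q ^ 2 ≤ 2 * (L * ‖d‖ ^ 2) * (γ * q / 2) := by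
      rcases eq_or_ne d 0 with h0 | h0
      · have : q = 0 := by rw [hq, h0, slope_zero, neg_zero]
        simp [this]
      · have hne : γ ≠ γmax := fun h => hlt ⟨h, h0⟩
        have heq : γ = q / (L * ‖d‖ ^ 2) := by
          rw [hγdef, stepSize]
          refine min_eq_left ?_
          by_contra! h
          exact hne (by rw [hγdef, stepSize, min_eq_right h.le])
        have hpos : 0 < L * ‖d‖ ^ 2 := by positivity
        rw [heq]
        field_simp
        rfl
    have hγq0 : 0 ≤ γ * q / 2 :=
      div_nonneg (mul_nonneg (stepSize_nonneg hγ hL hd) hq0) zero_le_two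
    calc w ^ 2 ≤ (2 * q) ^ 2 := by gcongr
      _ = 4 * q ^ 2 := by ring
      _ ≤ 4 * (2 * (L * ‖d‖ ^ 2) * (γ * q / 2)) := by gcongr
      _ ≤ 4 * (2 * (L * Metric.diam X ^ 2) * Δ) := by gcongr
      _ = _ := by ring

end IsDirection

end Iteration

/-! ### The contraction factor -/

section Rate

variable {M ν : ℝ} {f : Vec n → EReal} {X : Set (Vec n)} {x₀ : Vec n} {Linit τ : ℝ}

theorem Ltilde_pos (hL : 0 < Linit) : 0 < Ltilde f X x₀ Linit τ := lt_max_of_lt_right hL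

theorem smoothConst_le_Ltilde (hf : IsGenSelfConcordant M ν f) (hX : IsPolytope X)
    (hx₀ : x₀ ∈ X ∩ dom f) (hτ : 1 < τ) :
    smoothConst f (levelSet f X x₀) ≤ Ltilde f X x₀ Linit τ := by
  have h0 : 0 ≤ smoothConst f (levelSet f X x₀) :=
    (hf.strongConst_nonneg levelSet_subset_dom).trans
      (hf.strongConst_le_smoothConst (isCompact_levelSet hf hX hx₀.2) levelSet_subset_dom)
  exact (le_mul_of_one_le_left h0 hτ.le).trans (le_max_left _ _)

theorem diam_pos_of_nontrivial (hX : IsPolytope X) (h : X.Nontrivial) : 0 < Metric.diam X := by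
  obtain ⟨x, hx, y, hy, hxy⟩ := h
  exact (norm_pos_iff.2 (sub_ne_zero.2 hxy)).trans_le (hX.norm_sub_le_diam hx hy)

theorem diam_eq_zero_or_nontrivial (X : Set (Vec n)) : Metric.diam X = 0 ∨ X.Nontrivial := by
  rcases X.subsingleton_or_nontrivial with h | h
  · exact Or.inl (Metric.diam_subsingleton h)
  · exact Or.inr h

theorem atoms_nontrivial (hX : IsPolytope X) (hx₀ : x₀ ∈ X) (h : X.Nontrivial) :
    (insert x₀ (X.extremePoints ℝ)).Nontrivial := by
  by_contra hs
  rw [Set.not_nontrivial_iff] at hs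
  rw [← hX.convexHull_atoms hx₀] at h
  rcases hs.eq_empty_or_singleton with h0 | ⟨z, h0⟩
  · rw [h0, convexHull_empty] at h
    exact Set.not_nontrivial_empty h
  · rw [h0, convexHull_singleton] at h
    exact Set.not_nontrivial_singleton h

theorem atomWidth_nonneg (hX : IsPolytope X) (x₀ : Vec n) : 0 ≤ atomWidth X x₀ :=
  pyramidalWidth_nonneg (hX.finite_atoms x₀)

theorem atomWidth_div_diam_le_one (hX : IsPolytope X) (hx₀ : x₀ ∈ X) :
    atomWidth X x₀ / Metric.diam X ≤ 1 := by
  rcases diam_eq_zero_or_nontrivial X with h | h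
  · rw [h, div_zero]; exact zero_le_one
  · refine div_le_one_of_le₀ ?_ Metric.diam_nonneg
    have := pyramidalWidth_le_diam (hX.finite_atoms x₀) (atoms_nontrivial hX hx₀ h)
    rwa [hX.convexHull_atoms hx₀] at this

theorem rate_le_one (hf : IsGenSelfConcordant M ν f) (hL : 0 < Linit) :
    rate f X x₀ Linit τ ≤ 1 := by
  have h1 : 0 ≤ strongConst f (levelSet f X x₀) := hf.strongConst_nonneg levelSet_subset_dom
  have h2 := Ltilde_pos (f := f) (X := X) (x₀ := x₀) (τ := τ) hL
  exact sub_le_self _ (by positivity)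

/-- From `μ ≤ L_f ≤ L̃` and `δ ≤ D`. A full Frank-Wolfe step is only known to halve the gap, and
this bound shows that halving is at least as good as the factor claimed. -/
theorem half_le_rate (hf : IsGenSelfConcordant M ν f) (hX : IsPolytope X)
    (hx₀ : x₀ ∈ X ∩ dom f) (hL : 0 < Linit) (hτ : 1 < τ) : 1 / 2 ≤ rate f X x₀ Linit τ := by
  have h1 : 0 ≤ strongConst f (levelSet f X x₀) := hf.strongConst_nonneg levelSet_subset_dom
  have h2 := Ltilde_pos (f := f) (X := X) (x₀ := x₀) (τ := τ) hL
  have h3 : strongConst f (levelSet f X x₀) ≤ Ltilde f X x₀ Linit τ :=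
    (hf.strongConst_le_smoothConst (isCompact_levelSet hf hX hx₀.2) levelSet_subset_dom).trans
      (smoothConst_le_Ltilde hf hX hx₀ hτ)
  have h4 : strongConst f (levelSet f X x₀) / (4 * Ltilde f X x₀ Linit τ) ≤ 1 / 4 := by
    rw [div_le_iff₀ (by positivity)]
    linarith
  have h5 : (atomWidth X x₀ / Metric.diam X) ^ 2 ≤ 1 :=
    pow_le_one₀ (div_nonneg (atomWidth_nonneg hX x₀) Metric.diam_nonneg)
      (atomWidth_div_diam_le_one hX hx₀.1)
  have h6 := mul_le_mul h4 h5 (sq_nonneg _) (by norm_num)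
  rw [rate]
  linarith

theorem rate_lt_one (hf : IsGenSelfConcordant M ν f) (hν : 2 ≤ ν)
    (hline : ContainsNoLine (dom f)) (hX : IsPolytope X) (hx₀ : x₀ ∈ X ∩ dom f) (hL : 0 < Linit)
    (h : X.Nontrivial) : rate f X x₀ Linit τ < 1 := by
  have h1 := Ltilde_pos (f := f) (X := X) (x₀ := x₀) (τ := τ) hL
  have h2 : 0 < atomWidth X x₀ :=
    pyramidalWidth_pos (hX.finite_atoms x₀) (atoms_nontrivial hX hx₀.1 h)
  have h3 := diam_pos_of_nontrivial hX h
  obtain ⟨x, -, y, -, hxy⟩ := h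
  have h4 : 0 < strongConst f (levelSet f X x₀) :=
    hf.strongConst_pos hν hline (isCompact_levelSet hf hX hx₀.2) levelSet_subset_dom
      ⟨x₀, hx₀, le_rfl⟩ (sub_ne_zero.2 hxy)
  exact sub_lt_self _ (by positivity)

end Rate

/-! ### Runs of the algorithm -/

section Step

variable {M ν : ℝ} {f : Vec n → EReal} {X : Set (Vec n)} {x₀ x v a d : Vec n} {c : Vec n →₀ ℝ}
  {γmax L : ℝ}

theorem primalGap_sub (f : Vec n → EReal) (X : Set (Vec n)) (x y : Vec n) :
    primalGap f X x - primalGap f X y = val f x - val f y := by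
  rw [primalGap, primalGap]; ring

namespace IsDirection

theorem primalGap_step_le (hdir : IsDirection f X x c v a d γmax)
    (hf : IsGenSelfConcordant M ν f) (hX : IsPolytope X) (hx₀ : x₀ ∈ X ∩ dom f)
    (hit : IsIterate f X x₀ x c) {Linit τ : ℝ} (hLinit : 0 < Linit) (hτ : 1 < τ) (hL : 0 < L)
    (hLle : L ≤ Ltilde f X x₀ Linit τ) (hacc : Accepts f x d γmax L)
    (hdrop : ¬ (slope f x (x - v) < slope f x (a - x) ∧ stepSize f x d γmax L = γmax)) :
    primalGap f X (x + stepSize f x d γmax L • d) ≤ rate f X x₀ Linit τ * primalGap f X x := by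
  have hdec := hdir.decrease hf hX hx₀ hit hL hacc hdrop
  have hdec0 := hdir.decrease_nonneg hit hL hacc
  have hgeo := hdir.primalGap_le_sq hf hX hx₀ hit
  have hgap0 : 0 ≤ primalGap f X x :=
    primalGap_nonneg hf hX hx₀ hit.mem_levelSet.1
  have hrate := half_le_rate (Linit := Linit) (τ := τ) hf hX hx₀ hLinit hτ
  rw [← primalGap_sub f X] at hdec hdec0
  set h := primalGap f X x
  set h' := primalGap f X (x + stepSize f x d γmax L • d)
  rcases hdec with hdec | ⟨-, hdec⟩
  -- For a single point the quotient `δ / D` is `0` and the factor is `1`, so monotonicity is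
  -- enough.
  · rcases diam_eq_zero_or_nontrivial X with hD | hD
    · rw [rate, hD, div_zero]
      simpa using hdec0
    have hDpos := diam_pos_of_nontrivial hX hD
    rw [rate]
    set Lt := Ltilde f X x₀ Linit τ
    have hLt : 0 < Lt := Ltilde_pos hLinit
    set μ := strongConst f (levelSet f X x₀)
    set δ := atomWidth X x₀
    set D := Metric.diam X
    have h1 : 2 * μ * δ ^ 2 * h ≤ 8 * Lt * D ^ 2 * (h - h') :=
      hgeo.trans (hdec.trans (by gcongr))
    have h2 : μ / (4 * Lt) * (δ / D) ^ 2 * h ≤ h - h' := by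
      rw [div_pow, div_mul_div_comm, div_mul_eq_mul_div, div_le_iff₀ (by positivity)]
      linarith
    linarith
  · have := mul_le_mul_of_nonneg_right hrate hgap0
    linarith

theorem isIterate_fw (hdir : IsDirection f X x c v a d γmax)
    (hf : IsGenSelfConcordant M ν f) (hX : IsPolytope X) (hx₀ : x₀ ∈ X ∩ dom f)
    (hit : IsIterate f X x₀ x c) (hL : 0 < L) (hacc : Accepts f x d γmax L)
    (h : slope f x (a - x) ≤ slope f x (x - v)) :
    IsIterate f X x₀ (x + stepSize f x d γmax L • d)
      ((1 - stepSize f x d γmax L) • c + Finsupp.single v (stepSize f x d γmax L)) := by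
  have hcomb := hdir.fw_comb hit (stepSize_nonneg (hdir.γmax_nonneg hit) hL
    (hdir.slope_nonpos hit)) (min_le_right _ _) h
  have hsub : ((((1 - stepSize f x d γmax L) • c +
      Finsupp.single v (stepSize f x d γmax L)).support : Finset (Vec n)) : Set (Vec n)) ⊆
      insert x₀ (X.extremePoints ℝ) := by
    refine (Finset.coe_subset.2 fw_support_subset).trans ?_
    rw [Finset.coe_insert]
    exact Set.insert_subset (Set.mem_insert_of_mem _ hdir.vertex) hit.subset_atoms
  refine ⟨hcomb, hsub, mem_levelSet_of_val_le hf hx₀.2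
    (hcomb.mem_of_convex hX.convex (hsub.trans (atoms_subset hx₀.1))) hacc.1 ?_⟩
  have := hdir.decrease_nonneg hit hL hacc
  linarith [val_le_of_mem_levelSet hf hx₀.2 hit.mem_levelSet]

theorem isIterate_away (hdir : IsDirection f X x c v a d γmax)
    (hf : IsGenSelfConcordant M ν f) (hX : IsPolytope X) (hx₀ : x₀ ∈ X ∩ dom f)
    (hit : IsIterate f X x₀ x c) (hL : 0 < L) (hacc : Accepts f x d γmax L)
    (h : slope f x (x - v) < slope f x (a - x)) :
    IsIterate f X x₀ (x + stepSize f x d γmax L • d)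
      ((1 + stepSize f x d γmax L) • c - Finsupp.single a (stepSize f x d γmax L)) := by
  have hcomb := hdir.away_comb hit (stepSize_nonneg (hdir.γmax_nonneg hit) hL
    (hdir.slope_nonpos hit)) (min_le_right _ _) h
  have hsub := (Finset.coe_subset.2 (away_support_subset hdir.active
    (γ := stepSize f x d γmax L))).trans hit.subset_atoms
  refine ⟨hcomb, hsub, mem_levelSet_of_val_le hf hx₀.2
    (hcomb.mem_of_convex hX.convex (hsub.trans (atoms_subset hx₀.1))) hacc.1 ?_⟩
  have := hdir.decrease_nonneg hit hL hacc
  linarith [val_le_of_mem_levelSet hf hx₀.2 hit.mem_levelSet]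

/-- At maximal length the new weight `(1 + γmax) c a - γmax` of `a` is exactly zero, and away steps
add no atom. -/
theorem card_support_drop (hdir : IsDirection f X x c v a d γmax) (hit : IsIterate f X x₀ x c)
    (h : slope f x (x - v) < slope f x (a - x)) :
    ((1 + γmax) • c - Finsupp.single a γmax).support.card + 1 ≤ c.support.card := by
  have ha : ((1 + γmax) • c - Finsupp.single a γmax) a = 0 := by
    have hlt := sub_pos.2 (hdir.weight_lt_one hit h)
    have hγ : γmax * (1 - c a) = c a := by
      rw [(hdir.awayStep h).2, div_mul_cancel₀ _ hlt.ne']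
    simp
    linarith
  refine Nat.succ_le_of_lt (Finset.card_lt_card (Finset.ssubset_iff_subset_ne.2
    ⟨away_support_subset hdir.active, fun heq => ?_⟩))
  have hmem := hdir.active
  rw [← heq] at hmem
  exact Finsupp.mem_support_iff.1 hmem ha

/-- The gap is controlled by the primal gap, at a step that is not an away step of maximal
length. -/
theorem strongGap_le (hdir : IsDirection f X x c v a d γmax)
    (hf : IsGenSelfConcordant M ν f) (hX : IsPolytope X) (hx₀ : x₀ ∈ X ∩ dom f)
    (hit : IsIterate f X x₀ x c) {Lt : ℝ} (hL : 0 < L) (hLle : L ≤ Lt)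
    (hacc : Accepts f x d γmax L)
    (hgap' : 0 ≤ primalGap f X (x + stepSize f x d γmax L • d))
    (hdrop : ¬ (slope f x (x - v) < slope f x (a - x) ∧ stepSize f x d γmax L = γmax)) :
    strongGap f X x c.support ^ 2 ≤ 8 * Lt * Metric.diam X ^ 2 * primalGap f X x ∨
      strongGap f X x c.support ≤ 4 * primalGap f X x := by
  have hdec0 := hdir.decrease_nonneg hit hL hacc
  have hdec := hdir.decrease hf hX hx₀ hit hL hacc hdrop
  rw [← primalGap_sub f X] at hdec hdec0
  refine hdec.imp (fun h => h.trans ?_) fun h => by linarith [h.1]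
  have hle : primalGap f X x - primalGap f X (x + stepSize f x d γmax L • d) ≤
    primalGap f X x := by linarith
  have : 0 < Lt := hL.trans_le hLle
  gcongr

end IsDirection

/-- The bound on the gap in terms of a geometric bound on the primal gap. -/
theorem gap_bound_of_geometric {w h h0 ρ B : ℝ} {m k : ℕ} (hh0 : 0 ≤ h0) (hρ0 : 0 ≤ ρ)
    (hρ1 : ρ ≤ 1) (hB : 0 ≤ B) (hmk : 2 * k ≤ m) (hh : h ≤ h0 * ρ ^ m)
    (hw : w ^ 2 ≤ 8 * B * h ∨ w ≤ 4 * h) :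
    w ≤ 4 * h0 * max 1 (Real.sqrt (B / (2 * h0))) * ρ ^ k := by
  have hk : ρ ^ m ≤ (ρ ^ k) ^ 2 := by
    rw [← pow_mul, mul_comm]
    exact pow_le_pow_of_le_one hρ0 hρ1 hmk
  have hk0 : 0 ≤ ρ ^ k := pow_nonneg hρ0 k
  rcases hw with hw | hw
  · have hs : w ^ 2 ≤ (4 * h0 * Real.sqrt (B / (2 * h0)) * ρ ^ k) ^ 2 := by
      rw [mul_pow, mul_pow, Real.sq_sqrt (by positivity)]
      calc w ^ 2 ≤ 8 * B * (h0 * (ρ ^ k) ^ 2) :=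
            hw.trans (by gcongr; exact hh.trans (by gcongr))
        _ = (4 * h0) ^ 2 * (B / (2 * h0)) * (ρ ^ k) ^ 2 := by
            -- For `h0 = 0` both sides vanish, in accordance with the convention that the bound is
            -- then read as `0`.
            rcases hh0.eq_or_lt with h0' | h0'
            · simp [← h0']
            · field_simp; ring
    refine (abs_le_of_sq_le_sq' hs (by positivity)).2.trans ?_
    gcongr
    exact le_max_right _ _
  · have hk1 : ρ ^ k ≤ 1 := pow_le_one₀ hρ0 hρ1
    calc w ≤ 4 * (h0 * (ρ ^ k) ^ 2) :=
          hw.trans (by gcongr; exact hh.trans (by gcongr))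
      _ ≤ 4 * (h0 * (ρ ^ k * 1)) := by rw [sq]; gcongr
      _ = 4 * h0 * 1 * ρ ^ k := by ring
      _ ≤ _ := by gcongr; exact le_max_left _ _

end Step

/-! ### Invariants, counting of drop steps and the geometric rate along a run -/

section Run

variable {M ν : ℝ} {f : Vec n → EReal} {X : Set (Vec n)} {x₀ : Vec n} {Linit τ : ℝ} {N : ℕ}
  {R : Trace n}

namespace IsAFWRun

theorem isIterate_zero (h : IsAFWRun f X x₀ Linit τ N R) (hx₀ : x₀ ∈ X ∩ dom f) :
    IsIterate f X x₀ (R.x 0) (R.wt 0) := by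
  rw [h.x_zero, h.wt_zero]
  refine ⟨isProperConvexComb_single x₀, fun y hy => ?_, hx₀, le_rfl⟩
  have := Finsupp.support_single_subset hy
  simp only [Finset.mem_singleton] at this
  exact this ▸ Set.mem_insert _ _

theorem spec (h : IsAFWRun f X x₀ Linit τ N R) (hf : IsGenSelfConcordant M ν f)
    (hX : IsPolytope X) (hx₀ : x₀ ∈ X ∩ dom f) (hτ : 1 < τ) {t : ℕ} (ht : t < N)
    (hit : IsIterate f X x₀ (R.x t) (R.wt t)) (hL0 : 0 < R.L t)
    (hL1 : R.L t ≤ Ltilde f X x₀ Linit τ) :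
    0 < R.L (t + 1) ∧ R.L (t + 1) ≤ Ltilde f X x₀ Linit τ ∧
      Accepts f (R.x t) (R.d t) (R.γmax t) (R.L (t + 1)) ∧
      R.γ t = stepSize f (R.x t) (R.d t) (R.γmax t) (R.L (t + 1)) :=
  have hdir := h.direction t ht
  (h.backtrack t ht).spec hf hX hx₀.2 hit.mem_levelSet (hdir.γmax_nonneg hit)
    (hdir.add_smul_mem hX hx₀.1 hit) (hdir.slope_nonpos hit) hτ hL0 hL1

/-- Every iterate of a run satisfies the invariant, with bounded smoothness estimates. -/
theorem invariant (h : IsAFWRun f X x₀ Linit τ N R) (hf : IsGenSelfConcordant M ν f)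
    (hX : IsPolytope X) (hx₀ : x₀ ∈ X ∩ dom f) (hL : 0 < Linit) (hτ : 1 < τ) :
    ∀ t ≤ N, IsIterate f X x₀ (R.x t) (R.wt t) ∧ 0 < R.L t ∧
      R.L t ≤ Ltilde f X x₀ Linit τ := by
  intro t
  induction t with
  | zero => exact fun _ => ⟨h.isIterate_zero hx₀, by rw [h.L_zero]; exact hL, by
      rw [h.L_zero]; exact le_max_right _ _⟩
  | succ t ih =>
    intro ht
    obtain ⟨hit, hL0, hL1⟩ := ih (Nat.le_of_succ_le ht)
    obtain ⟨hL0', hL1', hacc, hγ⟩ := h.spec hf hX hx₀ hτ ht hit hL0 hL1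
    have hdir := h.direction t ht
    refine ⟨?_, hL0', hL1'⟩
    by_cases haway : R.IsAway f t
    · rw [h.x_succ t ht, h.wt_succ_away t ht haway, hγ]
      exact hdir.isIterate_away hf hX hx₀ hit hL0' hacc haway
    · rw [h.x_succ t ht, h.wt_succ_fw t ht haway, hγ]
      exact hdir.isIterate_fw hf hX hx₀ hit hL0' hacc (not_lt.1 haway)

theorem card_succ_of_isDrop (h : IsAFWRun f X x₀ Linit τ N R) {t : ℕ} (ht : t < N)
    (hit : IsIterate f X x₀ (R.x t) (R.wt t)) (hdrop : R.IsDrop f t) :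
    (R.wt (t + 1)).support.card + 1 ≤ (R.wt t).support.card := by
  rw [h.wt_succ_away t ht hdrop.1, hdrop.2]
  exact (h.direction t ht).card_support_drop hit hdrop.1

theorem card_succ_le (h : IsAFWRun f X x₀ Linit τ N R) {t : ℕ} (ht : t < N) :
    (R.wt (t + 1)).support.card ≤ (R.wt t).support.card + 1 := by
  classical
  by_cases haway : R.IsAway f t
  · rw [h.wt_succ_away t ht haway]
    exact (Finset.card_le_card (IsDirection.away_support_subset (h.direction t ht).active)).trans
      (Nat.le_succ _)
  · rw [h.wt_succ_fw t ht haway]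
    exact (Finset.card_le_card IsDirection.fw_support_subset).trans (Finset.card_insert_le _ _)

/-- After `t` iterations at least `t / 2` were not away steps of maximal length, and each of them
contracted the primal gap. -/
theorem exists_primalGap_le (h : IsAFWRun f X x₀ Linit τ N R) (hf : IsGenSelfConcordant M ν f)
    (hX : IsPolytope X) (hx₀ : x₀ ∈ X ∩ dom f) (hL : 0 < Linit) (hτ : 1 < τ) :
    ∀ t ≤ N, ∃ m : ℕ, (R.wt t).support.card + t ≤ 1 + 2 * m ∧
      primalGap f X (R.x t) ≤ primalGap f X x₀ * rate f X x₀ Linit τ ^ m := by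
  intro t
  induction t with
  | zero =>
    refine fun _ => ⟨0, ?_, by rw [h.x_zero]; simp⟩
    rw [h.wt_zero]
    simp
  | succ t ih =>
    intro ht
    obtain ⟨m, hm, hgap⟩ := ih (Nat.le_of_succ_le ht)
    obtain ⟨hit, hL0, hL1⟩ := h.invariant hf hX hx₀ hL hτ t (Nat.le_of_succ_le ht)
    obtain ⟨hL0', hL1', hacc, hγ⟩ := h.spec hf hX hx₀ hτ ht hit hL0 hL1
    have hdir := h.direction t ht
    -- A drop step leaves `|S_t| + t` no larger; any other step raises it by at most two and
    -- increases `m` by one.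
    by_cases hdrop : R.IsDrop f t
    · refine ⟨m, ?_, le_trans ?_ hgap⟩
      · have := h.card_succ_of_isDrop ht hit hdrop
        omega
      · have := hdir.decrease_nonneg hit hL0' hacc
        rw [← primalGap_sub f X, ← hγ, ← h.x_succ t ht] at this
        linarith
    · refine ⟨m + 1, ?_, ?_⟩
      · have := h.card_succ_le ht
        omega
      · have hstep := hdir.primalGap_step_le hf hX hx₀ hit hL hτ hL0' hL1' hacc
          (by rw [← hγ]; exact hdrop)
        rw [← hγ, ← h.x_succ t ht] at hstep
        have hrate := half_le_rate hf hX hx₀ hL hτ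
        calc _ ≤ _ := hstep
          _ ≤ rate f X x₀ Linit τ * (primalGap f X x₀ * rate f X x₀ Linit τ ^ m) := by
            refine mul_le_mul_of_nonneg_left hgap ?_
            linarith
          _ = _ := by ring

/-- The geometric bound on the gap at every iteration that is not an away step of maximal
length. -/
theorem strongGap_le (h : IsAFWRun f X x₀ Linit τ N R) (hf : IsGenSelfConcordant M ν f)
    (hX : IsPolytope X) (hx₀ : x₀ ∈ X ∩ dom f) (hL : 0 < Linit) (hτ : 1 < τ) {t : ℕ}
    (ht : t < N) (hdrop : ¬ R.IsDrop f t) :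
    strongGap f X (R.x t) (R.wt t).support ≤ 4 * primalGap f X x₀ *
      max 1 (Real.sqrt (Ltilde f X x₀ Linit τ * Metric.diam X ^ 2 / (2 * primalGap f X x₀))) *
      rate f X x₀ Linit τ ^ ((t - 1) / 4) := by
  obtain ⟨hit, hL0, hL1⟩ := h.invariant hf hX hx₀ hL hτ t ht.le
  obtain ⟨hL0', hL1', hacc, hγ⟩ := h.spec hf hX hx₀ hτ ht hit hL0 hL1
  obtain ⟨m, hm, hgap⟩ := h.exists_primalGap_le hf hX hx₀ hL hτ t ht.le
  -- A nonempty active set turns the count into `t ≤ 2 m`, hence `2 ⌊(t-1)/4⌋ ≤ m`.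
  have hcard : 0 < (R.wt t).support.card := Finset.card_pos.2 hit.comb.support_nonempty
  have hnext := (h.invariant hf hX hx₀ hL hτ (t + 1) ht).1
  have hgap' := primalGap_nonneg hf hX hx₀ hnext.mem_levelSet.1
  rw [h.x_succ t ht, hγ] at hgap'
  have hw := (h.direction t ht).strongGap_le hf hX hx₀ hit hL0' hL1' hacc hgap'
    (by rw [← hγ]; exact hdrop)
  have hLt := Ltilde_pos (f := f) (X := X) (x₀ := x₀) (τ := τ) hL
  have hrate := half_le_rate hf hX hx₀ hL hτ
  refine gap_bound_of_geometric (primalGap_nonneg hf hX hx₀ hx₀) (by linarith)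
    (rate_le_one hf hL) (by positivity) (by omega) hgap ?_
  simpa only [mul_assoc] using hw

/-- Each drop step removes an atom from an active set that has at most `|A|` elements and never
becomes empty. -/
theorem exists_not_isDrop (h : IsAFWRun f X x₀ Linit τ N R) (hf : IsGenSelfConcordant M ν f)
    (hX : IsPolytope X) (hx₀ : x₀ ∈ X ∩ dom f) (hL : 0 < Linit) (hτ : 1 < τ) {s k : ℕ}
    (hsk : s + k ≤ N) (hk : (insert x₀ (X.extremePoints ℝ)).ncard ≤ k) :
    ∃ t, s ≤ t ∧ t < s + k ∧ ¬ R.IsDrop f t := by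
  by_contra! hall
  have hcard : ∀ j ≤ k, (R.wt (s + j)).support.card + j ≤ (R.wt s).support.card := by
    intro j
    induction j with
    | zero => simp
    | succ j ih =>
      intro hj
      have hlt : s + j < N := by omega
      have := h.card_succ_of_isDrop hlt (h.invariant hf hX hx₀ hL hτ _ hlt.le).1
        (hall (s + j) (by omega) (by omega))
      have := ih (by omega)
      change (R.wt (s + j + 1)).support.card + (j + 1) ≤ _
      omega
  have h1 := hcard k le_rfl
  have h2 : 0 < (R.wt (s + k)).support.card :=
    Finset.card_pos.2 (h.invariant hf hX hx₀ hL hτ _ hsk).1.comb.support_nonempty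
  have h3 : (R.wt s).support.card ≤ (insert x₀ (X.extremePoints ℝ)).ncard := by
    rw [← Set.ncard_coe_finset]
    exact Set.ncard_le_ncard (h.invariant hf hX hx₀ hL hτ s (by omega)).1.subset_atoms
      (hX.finite_atoms x₀)
  omega

end IsAFWRun

/-- A geometric sequence with a bounded delay falls below `ε` after `O(log (1 / ε))` steps. -/
theorem exists_log_bound {B ρ : ℝ} (hρ0 : 0 < ρ) (hρ1 : ρ < 1) (K : ℕ) :
    ∃ C : ℝ, 0 < C ∧ ∀ ε : ℝ, 0 < ε → ε ≤ 1 / 2 → ∀ T : ℕ, C * Real.log (1 / ε) ≤ T →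
      K + 1 ≤ T ∧ ∀ t : ℕ, T ≤ t + K → B * ρ ^ ((t - 1) / 4) ≤ ε := by
  set l := Real.log (1 / ρ) with hl
  have hlpos : 0 < l := Real.log_pos ((one_lt_div hρ0).2 hρ1)
  set b := Real.log (max B 1) with hb
  have hb0 : 0 ≤ b := Real.log_nonneg (le_max_right _ _)
  have hlog2 : 0 < Real.log 2 := Real.log_pos one_lt_two
  -- The estimate needs `k l ≥ b + e` with `k = ⌊(t-1)/4⌋` and `t ≥ T - K`; the floor and the shift
  -- cost at most `4`. So `T ≥ K + 5 + 4 (b + e) / l` suffices, and `log 2 ≤ log (1 / ε)` absorbs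
  -- the part independent of `ε`.
  refine ⟨(K + 5 + 4 * b / l) / Real.log 2 + 4 / l, by positivity, fun ε hε hε2 T hT => ?_⟩
  have hlogε : Real.log 2 ≤ Real.log (1 / ε) := by
    refine Real.log_le_log two_pos ?_
    rw [le_div_iff₀ hε]; linarith
  set e := Real.log (1 / ε) with he
  have hT' : K + 5 + 4 * b / l + 4 / l * e ≤ T := by
    refine le_trans ?_ hT
    rw [add_mul]
    gcongr
    rw [div_mul_eq_mul_div, le_div_iff₀ hlog2]
    gcongr
  have he0 : 0 < e := hlog2.trans_le hlogε
  have hbl : 0 ≤ 4 * b / l := by positivity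
  have hel : 0 ≤ 4 / l * e := by positivity
  refine ⟨?_, fun t ht => ?_⟩
  · have : ((K + 1 : ℕ) : ℝ) ≤ T := by push_cast; linarith
    exact_mod_cast this
  set k := (t - 1) / 4 with hk
  have hk4 : (T : ℝ) ≤ 4 * k + 4 + K := by
    have : T ≤ 4 * k + 4 + K := by omega
    exact_mod_cast this
  have hkl : b + e ≤ k * l := by
    have h1 : 4 * b / l + 4 / l * e = 4 * ((b + e) / l) := by ring
    have h2 : (b + e) / l ≤ k := by linarith
    exact (div_le_iff₀ hlpos).1 h2
  have hmax : 0 < max B 1 := lt_max_of_lt_right one_pos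
  calc B * ρ ^ k ≤ max B 1 * ρ ^ k := by gcongr; exact le_max_left _ _
    _ = Real.exp (b - k * l) := by
      rw [Real.exp_sub, hb, Real.exp_log hmax, Real.exp_nat_mul, hl,
        Real.exp_log (by positivity), one_div, inv_pow, div_inv_eq_mul]
    _ ≤ Real.exp (-e) := Real.exp_le_exp.2 (by linarith)
    _ = ε := by rw [he, one_div, Real.log_inv, neg_neg, Real.exp_log hε]

end Run

end FrankWolfe

end

/-! ### Assembly of the three claims -/

theorem mainTheorem4 {n : ℕ} (M ν : ℝ) (hν : 2 ≤ ν)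
    (f : FrankWolfe.Vec n → EReal) (hf : FrankWolfe.IsGenSelfConcordant M ν f)
    (hline : FrankWolfe.ContainsNoLine (FrankWolfe.dom f))
    (X : Set (FrankWolfe.Vec n)) (hX : FrankWolfe.IsPolytope X)
    (x₀ : FrankWolfe.Vec n) (hx₀ : x₀ ∈ X ∩ FrankWolfe.dom f)
    (Linit τ : ℝ) (hL : 0 < Linit) (hτ : 1 < τ) :
    -- every call of the line search terminates
    (∀ (N : ℕ) (R : FrankWolfe.Trace n), FrankWolfe.IsAFWRun f X x₀ Linit τ N R →
      ∀ (v a d : FrankWolfe.Vec n) (γmax : ℝ),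
        FrankWolfe.IsDirection f X (R.x N) (R.wt N) v a d γmax →
        ∀ m : ℝ, FrankWolfe.IsInitialEstimate (R.L N) m →
          ∃ k : ℕ, FrankWolfe.Accepts f (R.x N) d γmax (τ ^ k * m)) ∧
    -- the geometric bound at every iteration that is not an away step of maximal length
    (∀ (N : ℕ) (R : FrankWolfe.Trace n), FrankWolfe.IsAFWRun f X x₀ Linit τ N R →
      ∀ t : ℕ, 1 ≤ t → t < N → ¬ R.IsDrop f t →
        FrankWolfe.fwGap f X (R.x t) ≤ FrankWolfe.strongGap f X (R.x t) (R.wt t).support ∧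
        FrankWolfe.strongGap f X (R.x t) (R.wt t).support ≤
          4 * FrankWolfe.primalGap f X x₀ *
            max 1 (Real.sqrt (FrankWolfe.Ltilde f X x₀ Linit τ * Metric.diam X ^ 2 /
              (2 * FrankWolfe.primalGap f X x₀))) *
            FrankWolfe.rate f X x₀ Linit τ ^ ((t - 1) / 4)) ∧
    -- `T = O(log (1 / ε))` iterations suffice for a Frank-Wolfe gap of at most `ε`
    (∃ C : ℝ, 0 < C ∧ ∀ ε : ℝ, 0 < ε → ε ≤ 1 / 2 →
      ∀ (T : ℕ) (R : FrankWolfe.Trace n), FrankWolfe.IsAFWRun f X x₀ Linit τ T R →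
        C * Real.log (1 / ε) ≤ (T : ℝ) →
          ∃ t : ℕ, 1 ≤ t ∧ t ≤ T ∧ FrankWolfe.fwGap f X (R.x t) ≤ ε) := by
  refine ⟨fun N R hR v a d γmax hdir m hm => ?_, fun N R hR t _ ht hdrop => ?_, ?_⟩
  · obtain ⟨hit, hL0, -⟩ := hR.invariant hf hX hx₀ hL hτ N le_rfl
    exact FrankWolfe.exists_accepts hf hX hx₀.2 hit.mem_levelSet (hdir.γmax_nonneg hit)
      (hdir.add_smul_mem hX hx₀.1 hit) (hdir.slope_nonpos hit) hτ (hm.pos hL0)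
  · exact ⟨(hR.direction t ht).fwGap_le_strongGap (hR.invariant hf hX hx₀ hL hτ t ht.le).1,
      hR.strongGap_le hf hX hx₀ hL hτ ht hdrop⟩
  · rcases X.subsingleton_or_nontrivial with hXs | hXn
    -- On a single point the factor is `1` and the geometric bound does not decay, but the gap is
    -- zero from the start.
    · refine ⟨1, one_pos, fun ε hε hε2 T R hR hT => ?_⟩
      have hT1 : 1 ≤ T := by
        have : 0 < Real.log (1 / ε) := Real.log_pos ((one_lt_div hε).2 (by linarith))
        have hTpos : (0 : ℝ) < T := by linarith
        exact_mod_cast hTpos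
      have hx := FrankWolfe.levelSet_subset (hR.invariant hf hX hx₀ hL hτ 1 hT1).1.mem_levelSet
      refine ⟨1, le_rfl, hT1, (csSup_le (Set.Nonempty.image _ ⟨_, hx⟩) ?_).trans hε.le⟩
      rintro _ ⟨y, hy, rfl⟩
      simp only [hXs hx hy, sub_self, FrankWolfe.slope_zero, le_refl]
    · have hrate := FrankWolfe.half_le_rate hf hX hx₀ hL hτ
      obtain ⟨C, hC, hbound⟩ := FrankWolfe.exists_log_bound
        (B := 4 * FrankWolfe.primalGap f X x₀ *
            max 1 (Real.sqrt (FrankWolfe.Ltilde f X x₀ Linit τ * Metric.diam X ^ 2 /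
              (2 * FrankWolfe.primalGap f X x₀))))
        (lt_of_lt_of_le one_half_pos hrate)
        (FrankWolfe.rate_lt_one hf hν hline hX hx₀ hL hXn)
        (insert x₀ (X.extremePoints ℝ)).ncard
      refine ⟨C, hC, fun ε hε hε2 T R hR hT => ?_⟩
      obtain ⟨hKT, hsmall⟩ := hbound ε hε hε2 T hT
      -- One of the last `|A|` iterations is not a drop step; `T ≥ |A| + 1` ensures `t ≥ 1`.
      obtain ⟨t, hst, htT, hdrop⟩ := hR.exists_not_isDrop hf hX hx₀ hL hτ
        (s := T - (insert x₀ (X.extremePoints ℝ)).ncard) (by omega) le_rfl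
      have htT' : t < T := by omega
      refine ⟨t, by omega, htT'.le, ?_⟩
      exact ((hR.direction t htT').fwGap_le_strongGap
        (hR.invariant hf hX hx₀ hL hτ t htT'.le).1).trans
        ((hR.strongGap_le hf hX hx₀ hL hτ htT' hdrop).trans (hsmall t (by omega)))
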